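/- Fix $r\in\mathbb{N}$. For $\rho\in 3^{<\mathbb{N}}$ and $\sigma=(\sigma_s)_{s<r}\in(2^{<\mathbb{N}})^r$ call $(\rho,\sigma)$ admissible if all $\sigma_s$ have the same length and this length is at most $|\rho|$; the prefix relation on such pairs is componentwise. A cross-tree is a set $T$ of admissible pairs such that every admissible prefix of an element of $T$ is in $T$. Its paths are the pairs $(X,Y)\in 3^{\mathbb{N}}\times(2^{\mathbb{N}})^r$, $Y=(Y_s)_{s<r}$, such that $(X{\upharpoonright}_n,(Y_s{\upharpoonright}_n)_{s<r})\in T$ for all $n$. The cross-tree $T$ is left-full if for every $X\in 3^{\mathbb{N}}$ there is some $Y\in(2^{\mathbb{N}})^r$ such that $(X,Y)$ is a path of $T$. Two colorings $f,g:\mathbb{N}\to k$ are finitely compatible if $f^{-1}(i)\cap g^{-1}(i)$ is finite for every $i<k$, and infinitely compatible otherwise. An instance of the cross-constraint problem $\mathsf{CC}$ is a left-full cross-tree $T$; a solution to $T$ is a pair $(X^0,Y^0),(X^1,Y^1)$ of paths of $T$ such that $X^0,X^1$ are finitely compatible and, for every $s<r$, $Y^0_s,Y^1_s$ are infinitely compatible.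 A Turing ideal is a nonempty class of subsets of $\mathbb{N}$ closed under joins and downward closed under Turing reducibility $\leq_T$. A cross-constraint ideal is a Turing ideal $\mathcal{M}$ such that every instance $T\in\mathcal{M}$ of $\mathsf{CC}$ has a solution with $(X^0,Y^0)\oplus(X^1,Y^1)\in\mathcal{M}$. (Strings are identified with natural numbers by a standard coding, and sequences with subsets of $\mathbb{N}$ through their graphs.) **Theorem.** Let $C\subseteq\mathbb{N}$ be non-computable. Then: 1. every computable instance $T$ of $\mathsf{CC}$ (that is, every computable left-full cross-tree $T$) has a solution $(X^0,Y^0),(X^1,Y^1)$ such that $C\not\leq_T (X^0,Y^0)\oplus(X^1,Y^1)$; 2. there is a cross-constraint ideal $\mathcal{M}$ with $C\notin\mathcal{M}$. -/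

import Mathlib

/-- `X ↾ n`: the string formed by the first `n` values of the sequence `X`. -/
def restrict {k : ℕ} (X : ℕ → Fin k) (n : ℕ) : List (Fin k) :=
  (List.range n).map X

/-- `σ ≺ X`: the string `σ` is an initial segment of the sequence `X`. -/
def IsInitialSegment {k : ℕ} (σ : List (Fin k)) (X : ℕ → Fin k) : Prop :=
  restrict X σ.length = σ

/-- Pairs `(ρ, σ)` with `ρ` a 3-valued string and `σ` an `r`-tuple of 2-valued strings. -/
abbrev CrossString (r : ℕ) : Type :=
  List (Fin 3) × (Fin r → List (Fin 2))

/-- The space `3^ℕ × (2^ℕ)^r`. -/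
abbrev CrossPoint (r : ℕ) : Type :=
  (ℕ → Fin 3) × (Fin r → ℕ → Fin 2)

namespace CrossString

variable {r : ℕ}

/-- The prefix relation, componentwise. -/
def IsPrefix (χ χ' : CrossString r) : Prop :=
  χ.1 <+: χ'.1 ∧ ∀ s, χ.2 s <+: χ'.2 s

/-- All the components of `σ` have the same length, which is at most the length of `ρ`. -/
def Admissible (χ : CrossString r) : Prop :=
  (∀ s t, (χ.2 s).length = (χ.2 t).length) ∧ ∀ s, (χ.2 s).length ≤ χ.1.length

/-- The pair of empty strings `(ε, ε)`. -/
def empty : CrossString r := ([], fun _ => [])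

end CrossString

/-- Cross-trees. All nodes are admissible, and the tree is closed under those prefixes which
are themselves admissible (a prefix of an admissible pair need not be admissible). -/
structure IsCrossTree {r : ℕ} (T : Set (CrossString r)) : Prop where
  admissible : ∀ χ ∈ T, χ.Admissible
  downward_closed : ∀ χ ∈ T, ∀ χ' : CrossString r, χ'.Admissible → χ'.IsPrefix χ → χ' ∈ T

/-- The class `[T]` of the infinite paths of `T`. -/
def crossPaths {r : ℕ} (T : Set (CrossString r)) : Set (CrossPoint r) :=
  {P | ∀ n, (restrict P.1 n, fun s => restrict (P.2 s) n) ∈ T}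

/-- The class `S` is left-full below `χ = (ρ, σ)`: for every `X` extending `ρ` there is some `Y`
extending `σ` with `(X, Y) ∈ S`. -/
def LeftFullBelow {r : ℕ} (S : Set (CrossPoint r)) (χ : CrossString r) : Prop :=
  ∀ X : ℕ → Fin 3, IsInitialSegment χ.1 X →
    ∃ Y : Fin r → ℕ → Fin 2, (∀ s, IsInitialSegment (χ.2 s) (Y s)) ∧ (X, Y) ∈ S

/-- Left-full means left-full below `(ε, ε)`. -/
def LeftFull {r : ℕ} (S : Set (CrossPoint r)) : Prop :=
  LeftFullBelow S CrossString.empty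

/-- Two colorings are finitely compatible if each color class of one meets the class of the same
color of the other in a finite set. -/
def FinitelyCompatible {k : ℕ} (f g : ℕ → Fin k) : Prop :=
  ∀ i : Fin k, (f ⁻¹' {i} ∩ g ⁻¹' {i}).Finite

/-- Infinitely compatible: not finitely compatible. -/
def InfinitelyCompatible {k : ℕ} (f g : ℕ → Fin k) : Prop :=
  ¬ FinitelyCompatible f g

/-- Instances of the cross-constraint problem: left-full cross-trees. -/
structure IsCCInstance {r : ℕ} (T : Set (CrossString r)) : Prop where
  isCrossTree : IsCrossTree T
  leftFull : LeftFull (crossPaths T)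

/-- Solutions `(P₀, P₁) = ((X⁰, Y⁰), (X¹, Y¹))` to the instance `T` of the cross-constraint
problem. -/
structure IsCCSolution {r : ℕ} (T : Set (CrossString r)) (P₀ P₁ : CrossPoint r) : Prop where
  mem_left : P₀ ∈ crossPaths T
  mem_right : P₁ ∈ crossPaths T
  finitelyCompatible : FinitelyCompatible P₀.1 P₁.1
  infinitelyCompatible : ∀ s, InfinitelyCompatible (P₀.2 s) (P₁.2 s)

/-- The characteristic function of a set of natural numbers. -/
noncomputable def charFun (A : Set ℕ) : ℕ → ℕ :=
  A.indicator 1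

/-- Turing reducibility `A ≤_T B` between sets of natural numbers. -/
def SetTuringLE (A B : Set ℕ) : Prop :=
  TuringReducible (fun n => Part.some (charFun A n)) (fun n => Part.some (charFun B n))

/-- The join `A ⊕ B` of two sets of natural numbers. -/
def setJoin (A B : Set ℕ) : Set ℕ :=
  (fun n => 2 * n) '' A ∪ (fun n => 2 * n + 1) '' B

/-- A point `(X, Y)` as a set of natural numbers: the disjoint union of the graphs of
`X, Y_0, …, Y_{r-1}`. -/
def CrossPoint.toSet {r : ℕ} (P : CrossPoint r) : Set ℕ :=
  {m | ∃ n, m = Nat.pair 0 (Nat.pair n (P.1 n : ℕ))} ∪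
    {m | ∃ (s : Fin r) (n : ℕ), m = Nat.pair ((s : ℕ) + 1) (Nat.pair n (P.2 s n : ℕ))}

/-- A set of pairs of strings as a set of natural numbers, through the same coding of pairs of
strings by natural numbers as the one underlying `ComputablePred`. -/
def crossCode {r : ℕ} (T : Set (CrossString r)) : Set ℕ :=
  (Primcodable.toEncodable : Encodable (CrossString r)).encode '' T

/-- Turing ideals: nonempty, closed downwards under Turing reducibility, closed under join. -/
structure IsTuringIdeal (M : Set (Set ℕ)) : Prop where
  nonempty : M.Nonempty
  downward_closed : ∀ A B : Set ℕ, SetTuringLE A B → B ∈ M → A ∈ M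
  join_mem : ∀ A ∈ M, ∀ B ∈ M, setJoin A B ∈ M

/-- Cross-constraint ideals (for `r`-tuples of 2-valued sequences). -/
structure IsCrossConstraintIdeal (r : ℕ) (M : Set (Set ℕ)) : Prop where
  isTuringIdeal : IsTuringIdeal M
  exists_solution : ∀ T : Set (CrossString r), IsCCInstance T → crossCode T ∈ M →
    ∃ P₀ P₁ : CrossPoint r, IsCCSolution T P₀ P₁ ∧ setJoin P₀.toSet P₁.toSet ∈ M

/-! A left-full cross-tree computable in `G` gives a relation `R X Y` that is closed effectively in
`G` and in which every `X` has a partner `Y`. The core is `hasAvoidingSolution`, a statement about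
such relations proved by strong induction on the number `r` of columns of `Y`.

Two tools add a sequence to an oracle without computing `C`: the cone avoidance basis theorem
(`exists_mem_avoids`), which picks a member of a nonempty effectively closed class over a finite
alphabet, and Baire category (`exists_generic_avoids`), which picks a sequence in countably many
prescribed dense open sets.

Let `V` be given. The sequences that differ from `V` everywhere beyond a string `L` may have
partners that all share some columns `Z`. Choose a largest set of `m` columns for which this
happens, with a fixed `L`, for all `V` extending some string `M`. If `m = r`, a single `Y` is a
partner of two sequences that differ almost everywhere, and the problem is solved. If `m < r`, the
relation between `V` and its shared columns `Z` is again effectively closed and full, with only `m`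
columns. The induction hypothesis gives a solution `(V₀, Z₀), (V₁, Z₁)`, with `V₀` generic enough
that, by maximality of `m`, no further column is shared for it.

Since `V₀` and `V₁` differ almost everywhere, a finite modification `W` of `V₀` differs from `V₁`
beyond `L`, so it has a partner `Y` with columns `Z₁`. Sequences that differ from `V₀` have partners
with columns `Z₀`, and genericity yields `r + 1` of them whose remaining columns are pairwise not
almost equal. A column finitely compatible with that of `Y` is almost its complement, so by
pigeonhole one of the `r + 1` partners is infinitely compatible with `Y` in every remaining column;
in the shared columns the induction hypothesis applies.

For the ideal, the solutions are joined one after another to a growing set `G n`, every instance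
computable in some `G m` being treated at a later stage; the sets computable in some `G n` form the
ideal. -/

open Encodable

/-! ### Effectively open relations between arguments and oracles -/

section EffOpen

variable {α β σ : Type*} [Primcodable α] [Primcodable β] [Primcodable σ]

/-- The first `n` values of an oracle. -/
def oraclePrefix (p : ℕ → ℕ) (n : ℕ) : List ℕ :=
  (List.range n).map p

@[simp] theorem length_oraclePrefix (p : ℕ → ℕ) (n : ℕ) : (oraclePrefix p n).length = n := by
  simp [oraclePrefix]

theorem take_oraclePrefix (p : ℕ → ℕ) (k n : ℕ) :
    (oraclePrefix p n).take k = oraclePrefix p (min k n) := by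
  simp [oraclePrefix, ← List.map_take, List.take_range]

theorem oraclePrefix_getElem? (p : ℕ → ℕ) (i n : ℕ) :
    (oraclePrefix p n)[i]? = if i < n then some (p i) else none := by
  by_cases h : i < n
  · simp [oraclePrefix, h]
  · simp [oraclePrefix, h]

theorem oraclePrefix_congr {p q : ℕ → ℕ} {n : ℕ} (h : ∀ i < n, p i = q i) :
    oraclePrefix p n = oraclePrefix q n := by
  simpa [oraclePrefix] using h

@[simp] theorem oraclePrefix_getElem (p : ℕ → ℕ) (i n : ℕ) (h : i < (oraclePrefix p n).length) :
    (oraclePrefix p n)[i] = p i := by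
  simp [oraclePrefix]

/-- A relation between arguments and oracles is effectively open if it is enumerated, uniformly,
by a primitive recursive relation on arguments and finite initial segments of oracles. -/
def EffOpen (U : α → (ℕ → ℕ) → Prop) : Prop :=
  ∃ E : α → List ℕ → Prop, PrimrecRel E ∧ ∀ a p, U a p ↔ ∃ n, E a (oraclePrefix p n)

theorem PrimrecPred.exists_lt_param {P : β → ℕ → Prop} (hP : PrimrecRel P) {f : β → ℕ}
    (hf : Primrec f) : PrimrecPred fun b => ∃ i < f b, P b i :=
  ((PrimrecRel.exists_mem_list (R := fun (i : ℕ) (b : β) => P b i)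
    (hP.comp Primrec.snd Primrec.fst)).comp (Primrec.list_range.comp hf) Primrec.id).of_eq
    (by simp)

theorem PrimrecPred.forall_lt_param {P : β → ℕ → Prop} (hP : PrimrecRel P) {f : β → ℕ}
    (hf : Primrec f) : PrimrecPred fun b => ∀ i < f b, P b i :=
  ((PrimrecRel.forall_mem_list (R := fun (i : ℕ) (b : β) => P b i)
    (hP.comp Primrec.snd Primrec.fst)).comp (Primrec.list_range.comp hf) Primrec.id).of_eq
    (by simp)

/-- Accepting a string as soon as one of its prefixes is accepted makes the enumeration monotone.
Several conditions can then be tested on one common long prefix. -/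
theorem EffOpen.exists_monotone {U : α → (ℕ → ℕ) → Prop} (hU : EffOpen U) :
    ∃ E : α → List ℕ → Prop, PrimrecRel E ∧ (∀ a l l', l <+: l' → E a l → E a l') ∧
      ∀ a p, U a p ↔ ∃ n, E a (oraclePrefix p n) := by
  obtain ⟨E, hE, hUE⟩ := hU
  refine ⟨fun a l => ∃ n < l.length + 1, E a (l.take n), ?_, ?_, ?_⟩
  · refine PrimrecPred.exists_lt_param (β := α × List ℕ) (P := fun b n => E b.1 (b.2.take n))
      ?_ (Primrec.succ.comp (Primrec.list_length.comp Primrec.snd))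
    exact hE.comp (Primrec.fst.comp Primrec.fst)
      (Primrec.list_take.comp Primrec.snd (Primrec.snd.comp Primrec.fst))
  · rintro a l l' ⟨t, rfl⟩ ⟨n, hn, h⟩
    refine ⟨n, by simp; omega, ?_⟩
    rwa [List.take_append_of_le_length (by omega)]
  · intro a p
    rw [hUE]
    constructor
    · rintro ⟨n, hn⟩
      exact ⟨n, n, by simp, by simpa [take_oraclePrefix] using hn⟩
    · rintro ⟨n, k, hk, h⟩
      rw [take_oraclePrefix] at h
      exact ⟨_, h⟩

theorem oraclePrefix_prefix (p : ℕ → ℕ) {m n : ℕ} (h : m ≤ n) :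
    oraclePrefix p m <+: oraclePrefix p n := by
  rw [← min_eq_left h, ← take_oraclePrefix]
  exact List.take_prefix _ _

theorem EffOpen.of_eq {U V : α → (ℕ → ℕ) → Prop} (hU : EffOpen U) (h : ∀ a p, U a p ↔ V a p) :
    EffOpen V := by
  have : U = V := by ext a p; exact h a p
  exact this ▸ hU

theorem EffOpen.of_primrecPred {P : α → Prop} (hP : PrimrecPred P) :
    EffOpen fun a (_ : ℕ → ℕ) => P a :=
  ⟨fun a _ => P a, hP.comp Primrec.fst, fun a p => by simp⟩

theorem EffOpen.and {U V : α → (ℕ → ℕ) → Prop} (hU : EffOpen U) (hV : EffOpen V) :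
    EffOpen fun a p => U a p ∧ V a p := by
  obtain ⟨E, hE, mE, hUE⟩ := hU.exists_monotone
  obtain ⟨F, hF, mF, hVF⟩ := hV.exists_monotone
  refine ⟨fun a l => E a l ∧ F a l, PrimrecPred.and hE hF, fun a p => ?_⟩
  simp only [hUE, hVF]
  constructor
  · rintro ⟨⟨m, hm⟩, n, hn⟩
    exact ⟨max m n, mE _ _ _ (oraclePrefix_prefix p (le_max_left m n)) hm,
      mF _ _ _ (oraclePrefix_prefix p (le_max_right m n)) hn⟩
  · rintro ⟨n, h, h'⟩
    exact ⟨⟨n, h⟩, n, h'⟩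

theorem EffOpen.or {U V : α → (ℕ → ℕ) → Prop} (hU : EffOpen U) (hV : EffOpen V) :
    EffOpen fun a p => U a p ∨ V a p := by
  obtain ⟨E, hE, hUE⟩ := hU
  obtain ⟨F, hF, hVF⟩ := hV
  refine ⟨fun a l => E a l ∨ F a l, PrimrecPred.or hE hF, fun a p => ?_⟩
  simp only [hUE, hVF, exists_or]

theorem EffOpen.comp {U : α → (ℕ → ℕ) → Prop} (hU : EffOpen U) {f : β → α} (hf : Primrec f) :
    EffOpen fun b p => U (f b) p := by
  obtain ⟨E, hE, hUE⟩ := hU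
  exact ⟨fun b l => E (f b) l, hE.comp (hf.comp Primrec.fst) Primrec.snd, fun b p => hUE _ _⟩

/-- The length of the oracle prefix also serves as a stage counter: at length `n` only witnesses
with code below `n` are tried, which keeps the search primitive recursive. -/
theorem EffOpen.exists {U : α × β → (ℕ → ℕ) → Prop} (hU : EffOpen U) :
    EffOpen fun a p => ∃ b, U (a, b) p := by
  obtain ⟨E, hE, mE, hUE⟩ := hU.exists_monotone
  refine ⟨fun a l => ∃ i < l.length, ∃ b ∈ (decode (α := β) i).toList, E (a, b) l, ?_, ?_⟩
  · refine PrimrecPred.exists_lt_param (β := α × List ℕ)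
      (P := fun x i => ∃ b ∈ (decode (α := β) i).toList, E (x.1, b) x.2) ?_
      (Primrec.list_length.comp Primrec.snd)
    refine (PrimrecRel.exists_mem_list (R := fun (b : β) (x : α × List ℕ) => E (x.1, b) x.2)
      ?_).comp (g := fun x : (α × List ℕ) × ℕ => x.1)
      (f := fun x => (decode (α := β) x.2).toList) ?_ Primrec.fst
    · exact hE.comp (Primrec.pair (Primrec.fst.comp Primrec.snd) Primrec.fst)
        (Primrec.snd.comp Primrec.snd)
    · exact Primrec.optionToList.comp (Primrec.decode.comp Primrec.snd)
  · intro a p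
    constructor
    · rintro ⟨b, hb⟩
      obtain ⟨n, hn⟩ := (hUE _ _).1 hb
      refine ⟨max n (encode b + 1), encode b, by simp, b, by simp, ?_⟩
      exact mE _ _ _ (oraclePrefix_prefix p (le_max_left _ _)) hn
    · rintro ⟨n, i, -, b, -, h⟩
      exact ⟨b, (hUE _ _).2 ⟨n, h⟩⟩

theorem EffOpen.forall_lt {U : α × ℕ → (ℕ → ℕ) → Prop} (hU : EffOpen U) {f : α → ℕ}
    (hf : Primrec f) : EffOpen fun a p => ∀ i < f a, U (a, i) p := by
  obtain ⟨E, hE, mE, hUE⟩ := hU.exists_monotone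
  refine ⟨fun a l => ∀ i < f a, E (a, i) l, ?_, fun a p => ?_⟩
  · refine PrimrecPred.forall_lt_param (β := α × List ℕ) (P := fun x i => E (x.1, i) x.2) ?_
      (hf.comp Primrec.fst)
    exact hE.comp (Primrec.pair (Primrec.fst.comp Primrec.fst) Primrec.snd)
      (Primrec.snd.comp Primrec.fst)
  · constructor
    · intro h
      have h' : ∀ i, ∃ n, i < f a → E (a, i) (oraclePrefix p n) := fun i => by
        by_cases hi : i < f a
        · obtain ⟨n, hn⟩ := (hUE _ _).1 (h i hi)
          exact ⟨n, fun _ => hn⟩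
        · exact ⟨0, fun h => absurd h hi⟩
      choose N hN using h'
      refine ⟨(Finset.range (f a)).sup N, fun i hi => mE _ _ _ (oraclePrefix_prefix p ?_) (hN i hi)⟩
      exact Finset.le_sup (f := N) (Finset.mem_range.2 hi)
    · rintro ⟨n, h⟩ i hi
      exact (hUE _ _).2 ⟨n, h i hi⟩

theorem effOpen_apply : EffOpen fun (x : ℕ × ℕ) p => p x.1 = x.2 := by
  refine ⟨fun x l => l[x.1]? = some x.2, ?_, fun x p => ?_⟩
  · exact Primrec.eq.comp
      (Primrec.list_getElem?.comp Primrec.snd (Primrec.fst.comp Primrec.fst))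
      (Primrec.option_some.comp (Primrec.snd.comp Primrec.fst))
  · simp only [oraclePrefix_getElem?]
    constructor
    · intro h
      exact ⟨x.1 + 1, by simp [h]⟩
    · rintro ⟨n, h⟩
      by_contra hne
      split_ifs at h
      simp_all

/-- Substitution of oracles: `Γ a p` is an oracle computed from `p`, uniformly in `a`. -/
theorem EffOpen.subst {U : α → (ℕ → ℕ) → Prop} (hU : EffOpen U) {Γ : α → (ℕ → ℕ) → ℕ → ℕ}
    (hΓ : EffOpen fun (x : (α × ℕ) × ℕ) p => Γ x.1.1 p x.1.2 = x.2) :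
    EffOpen fun a p => U a (Γ a p) := by
  obtain ⟨E, hE, hUE⟩ := hU
  have h1 : EffOpen fun (x : (α × List ℕ) × ℕ) p =>
      Γ x.1.1 p x.2 = x.1.2.getD x.2 0 :=
    hΓ.comp (f := fun x : (α × List ℕ) × ℕ => ((x.1.1, x.2), x.1.2.getD x.2 0)) <|
      Primrec.pair (Primrec.pair (Primrec.fst.comp Primrec.fst) Primrec.snd)
        ((Primrec.list_getD 0).comp (Primrec.snd.comp Primrec.fst) Primrec.snd)
  have h2 : EffOpen fun (x : α × List ℕ) p =>
      ∀ i < x.2.length, Γ x.1 p i = x.2.getD i 0 :=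
    h1.forall_lt (Primrec.list_length.comp Primrec.snd)
  refine ((EffOpen.of_primrecPred hE).and h2).exists.of_eq fun a p => ?_
  rw [hUE]
  constructor
  · rintro ⟨l, hl, h⟩
    refine ⟨l.length, ?_⟩
    convert hl
    apply List.ext_getElem (by simp)
    intro i h1 h2
    simpa [oraclePrefix, List.getD_eq_getElem?_getD, h2] using h i h2
  · rintro ⟨n, hn⟩
    refine ⟨_, hn, fun i hi => ?_⟩
    simp at hi
    simp [List.getD_eq_getElem?_getD, hi]

/-- A finite list is guessed and checked entry by entry against the oracle. -/
theorem EffOpen.exists_prefix {U : α × List ℕ → (ℕ → ℕ) → Prop} (hU : EffOpen U) :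
    EffOpen fun a p => ∃ n, U (a, oraclePrefix p n) p := by
  have h1 : EffOpen fun (x : (α × List ℕ) × ℕ) p => p x.2 = x.1.2.getD x.2 0 :=
    effOpen_apply.comp (f := fun x : (α × List ℕ) × ℕ => (x.2, x.1.2.getD x.2 0)) <|
      Primrec.pair Primrec.snd ((Primrec.list_getD 0).comp (Primrec.snd.comp Primrec.fst) Primrec.snd)
  have h2 : EffOpen fun (x : α × List ℕ) p => ∀ i < x.2.length, p i = x.2.getD i 0 :=
    h1.forall_lt (Primrec.list_length.comp Primrec.snd)
  refine (hU.and h2).exists.of_eq fun a p => ?_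
  constructor
  · rintro ⟨l, hl, h⟩
    refine ⟨l.length, ?_⟩
    convert hl
    apply List.ext_getElem (by simp)
    intro i h1 h2
    simpa [oraclePrefix, List.getD_eq_getElem?_getD, h2] using h i h2
  · rintro ⟨n, hn⟩
    refine ⟨_, hn, fun i hi => ?_⟩
    simp at hi
    simp [List.getD_eq_getElem?_getD, hi]

/-- An effectively open relation is determined by the 0-1 function that decides its enumeration on
codes, and there are countably many computable functions. Countability is what allows all
requirements to be met in a sequence or by a Baire argument. -/
instance countable_effOpen : Countable {U : ℕ → (ℕ → ℕ) → Prop // EffOpen U} := by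
  have : (Set.univ : Set {U : ℕ → (ℕ → ℕ) → Prop // EffOpen U}).Countable := by
    apply Set.MapsTo.countable_of_injOn (f := Subtype.val)
      (t := Set.range fun (f : {f : ℕ → ℕ // Computable f}) (a : ℕ) (p : ℕ → ℕ) =>
        ∃ n, f.1 (encode (a, oraclePrefix p n)) = 1)
    · rintro ⟨U, E, ⟨hd, hE⟩, hUE⟩ -
      refine ⟨⟨fun n => (((decode (α := ℕ × List ℕ) n).map fun x =>
        decide (E x.1 x.2)).getD false).toNat, ?_⟩, ?_⟩
      · refine Primrec.to_comp ?_
        exact (Primrec.dom_finite Bool.toNat).comp <| Primrec.option_getD.comp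
          (Primrec.option_map Primrec.decode (hE.comp Primrec.snd).to₂) (Primrec.const false)
      · ext a p
        simp only [encodek, Option.map_some, Option.getD_some, hUE]
        simp [Bool.toNat_eq_one]
    · exact Subtype.val_injective.injOn
    · exact Set.countable_range _
  exact Set.countable_univ_iff.1 this

end EffOpen

/-! ### Relative enumerability and avoidance of `C` -/

section Enumerable

variable {α β : Type*} [Primcodable α] [Primcodable β] {g : ℕ → ℕ}

/-- `W` is enumerable relative to the oracle `g`. -/
def EnumIn (g : ℕ → ℕ) (W : α → Prop) : Prop :=
  ∃ U : α → (ℕ → ℕ) → Prop, EffOpen U ∧ ∀ a, W a ↔ U a g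

theorem EnumIn.of_eq {V W : α → Prop} (hV : EnumIn g V) (h : ∀ a, V a ↔ W a) : EnumIn g W := by
  have : V = W := by ext a; exact h a
  exact this ▸ hV

theorem EnumIn.of_primrecPred {P : α → Prop} (hP : PrimrecPred P) : EnumIn g P :=
  ⟨_, EffOpen.of_primrecPred hP, fun _ => Iff.rfl⟩

theorem EnumIn.and {V W : α → Prop} (hV : EnumIn g V) (hW : EnumIn g W) :
    EnumIn g fun a => V a ∧ W a := by
  obtain ⟨U, hU, hVU⟩ := hV
  obtain ⟨U', hU', hWU'⟩ := hW
  exact ⟨_, hU.and hU', fun a => and_congr (hVU a) (hWU' a)⟩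

theorem EnumIn.or {V W : α → Prop} (hV : EnumIn g V) (hW : EnumIn g W) :
    EnumIn g fun a => V a ∨ W a := by
  obtain ⟨U, hU, hVU⟩ := hV
  obtain ⟨U', hU', hWU'⟩ := hW
  exact ⟨_, hU.or hU', fun a => or_congr (hVU a) (hWU' a)⟩

theorem EnumIn.comp {W : α → Prop} (hW : EnumIn g W) {f : β → α} (hf : Primrec f) :
    EnumIn g fun b => W (f b) := by
  obtain ⟨U, hU, hWU⟩ := hW
  exact ⟨_, hU.comp hf, fun b => hWU (f b)⟩

theorem EnumIn.exists {W : α × β → Prop} (hW : EnumIn g W) : EnumIn g fun a => ∃ b, W (a, b) := by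
  obtain ⟨U, hU, hWU⟩ := hW
  exact ⟨_, hU.exists, fun a => exists_congr fun b => hWU (a, b)⟩

theorem EnumIn.forall_lt {W : α × ℕ → Prop} (hW : EnumIn g W) {f : α → ℕ} (hf : Primrec f) :
    EnumIn g fun a => ∀ i < f a, W (a, i) := by
  obtain ⟨U, hU, hWU⟩ := hW
  exact ⟨_, hU.forall_lt hf, fun a => forall₂_congr fun i _ => hWU (a, i)⟩

/-- The graph of a partial function that is recursive in `g` is enumerable relative to `g`. -/
theorem enumIn_graph_of_recursiveIn {f : ℕ →. ℕ}
    (hf : Nat.RecursiveIn {fun n => Part.some (g n)} f) :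
    EnumIn g fun x : ℕ × ℕ => x.2 ∈ f x.1 := by
  induction hf with
  | zero =>
    refine (EnumIn.of_primrecPred (Primrec.eq.comp Primrec.snd (Primrec.const 0))).of_eq fun x => ?_
    exact Part.mem_some_iff.symm
  | succ =>
    refine (EnumIn.of_primrecPred (Primrec.eq.comp Primrec.snd
      (Primrec.succ.comp Primrec.fst))).of_eq fun x => ?_
    exact Part.mem_some_iff.symm
  | left =>
    refine (EnumIn.of_primrecPred (Primrec.eq.comp Primrec.snd
      (Primrec.fst.comp (Primrec.unpair.comp Primrec.fst)))).of_eq fun x => ?_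
    exact Part.mem_some_iff.symm
  | right =>
    refine (EnumIn.of_primrecPred (Primrec.eq.comp Primrec.snd
      (Primrec.snd.comp (Primrec.unpair.comp Primrec.fst)))).of_eq fun x => ?_
    exact Part.mem_some_iff.symm
  | oracle h hh =>
    obtain rfl : h = _ := hh
    exact ⟨_, effOpen_apply, fun x => by simp [eq_comm]⟩
  | @pair f h _ _ ihf ihh =>
    have h1 := ihf.comp (f := fun x : (ℕ × ℕ) × (ℕ × ℕ) => (x.1.1, x.2.1))
      ((Primrec.fst.comp Primrec.fst).pair (Primrec.fst.comp Primrec.snd))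
    have h2 := ihh.comp (f := fun x : (ℕ × ℕ) × (ℕ × ℕ) => (x.1.1, x.2.2))
      ((Primrec.fst.comp Primrec.fst).pair (Primrec.snd.comp Primrec.snd))
    have h3 : EnumIn g fun x : (ℕ × ℕ) × (ℕ × ℕ) => x.1.2 = Nat.pair x.2.1 x.2.2 :=
      EnumIn.of_primrecPred (Primrec.eq.comp (Primrec.snd.comp Primrec.fst)
        (Primrec₂.natPair.comp (Primrec.fst.comp Primrec.snd) (Primrec.snd.comp Primrec.snd)))
    refine ((h1.and h2).and h3).exists.of_eq fun x => ?_
    simp [Seq.seq, eq_comm, and_assoc]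
  | @comp f h _ _ ihf ihh =>
    have h1 := ihh.comp (f := fun x : (ℕ × ℕ) × ℕ => (x.1.1, x.2))
      ((Primrec.fst.comp Primrec.fst).pair Primrec.snd)
    have h2 := ihf.comp (f := fun x : (ℕ × ℕ) × ℕ => (x.2, x.1.2))
      (Primrec.snd.pair (Primrec.snd.comp Primrec.fst))
    refine (h1.and h2).exists.of_eq fun x => ?_
    refine ⟨fun ⟨b, hb, hy⟩ => Part.mem_bind hb hy, fun hx => ?_⟩
    obtain ⟨b, hb, hy⟩ := Part.mem_bind_iff.1 hx
    exact ⟨b, hb, hy⟩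
  | @prec f h _ _ ihf ihh =>
    -- A value of the recursion is witnessed by the list of all intermediate values, of which only
    -- finitely many links have to be checked.
    have hget : Primrec₂ fun (l : List ℕ) (n : ℕ) => l.getD n 0 := Primrec.list_getD 0
    have pa : Primrec fun x : (ℕ × ℕ) × List ℕ => x.1.1.unpair.1 :=
      Primrec.fst.comp (Primrec.unpair.comp (Primrec.fst.comp Primrec.fst))
    have pn : Primrec fun x : (ℕ × ℕ) × List ℕ => x.1.1.unpair.2 :=
      Primrec.snd.comp (Primrec.unpair.comp (Primrec.fst.comp Primrec.fst))
    have h1 := ihf.comp (f := fun x : (ℕ × ℕ) × List ℕ => (x.1.1.unpair.1, x.2.getD 0 0))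
      (pa.pair (hget.comp Primrec.snd (Primrec.const 0)))
    have h2 := (ihh.comp (f := fun x : ((ℕ × ℕ) × List ℕ) × ℕ =>
        (Nat.pair x.1.1.1.unpair.1 (Nat.pair x.2 (x.1.2.getD x.2 0)), x.1.2.getD (x.2 + 1) 0))
      ((Primrec₂.natPair.comp (pa.comp Primrec.fst) (Primrec₂.natPair.comp Primrec.snd
        (hget.comp (Primrec.snd.comp Primrec.fst) Primrec.snd))).pair
        (hget.comp (Primrec.snd.comp Primrec.fst) (Primrec.succ.comp Primrec.snd)))).forall_lt pn
    have h3 : EnumIn g fun x : (ℕ × ℕ) × List ℕ => x.2.getD x.1.1.unpair.2 0 = x.1.2 :=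
      EnumIn.of_primrecPred (Primrec.eq.comp (hget.comp Primrec.snd pn)
        (Primrec.snd.comp Primrec.fst))
    refine ((h1.and h2).and h3).exists.of_eq ?_
    rintro ⟨m, y⟩
    simp only
    generalize m.unpair.1 = a
    generalize m.unpair.2 = n
    constructor
    · rintro ⟨l, ⟨hl0, hl⟩, rfl⟩
      have : ∀ k ≤ n, l.getD k 0 ∈ (Nat.rec (f a) (fun y IH => IH.bind fun i =>
          h (Nat.pair a (Nat.pair y i))) k : Part ℕ) := by
        intro k
        induction k with
        | zero => intro _; exact hl0
        | succ k ih =>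
          intro hk
          exact Part.mem_bind (ih (by omega)) (hl k (by omega))
      exact this n le_rfl
    · intro hy
      have : ∀ k y, y ∈ (Nat.rec (f a) (fun y IH => IH.bind fun i =>
          h (Nat.pair a (Nat.pair y i))) k : Part ℕ) →
          ∃ l : List ℕ, l.length = k + 1 ∧ (l.getD 0 0 ∈ f a ∧ ∀ i < k, l.getD (i + 1) 0 ∈
            h (Nat.pair a (Nat.pair i (l.getD i 0)))) ∧ l.getD k 0 = y := by
        intro k
        induction k with
        | zero => intro y hy; exact ⟨[y], by simp, ⟨by simpa using hy, by simp⟩, by simp⟩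
        | succ k ih =>
          intro y hy
          obtain ⟨i, hi, hy⟩ := Part.mem_bind_iff.1 hy
          obtain ⟨l, hlen, ⟨h0, hl⟩, hlk⟩ := ih i hi
          have e1 : ∀ j ≤ k, (l ++ [y]).getD j 0 = l.getD j 0 := fun j hj => by
            rw [List.getD_append _ _ _ _ (by omega)]
          have e2 : (l ++ [y]).getD (k + 1) 0 = y := by
            rw [List.getD_append_right _ _ _ _ (by omega)]; simp [hlen]
          refine ⟨l ++ [y], by simp [hlen], ⟨by rwa [e1 0 (by omega)], fun j hj => ?_⟩, e2⟩
          rcases Nat.lt_succ_iff_lt_or_eq.1 hj with hj' | rfl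
          · rw [e1 _ (by omega), e1 _ (by omega)]
            exact hl j hj'
          · rw [e2, e1 _ le_rfl, hlk]
            exact hy
      obtain ⟨l, -, hl⟩ := this n y hy
      exact ⟨l, hl⟩
  | @rfind f _ ihf =>
    have h1 := ihf.comp (f := fun x : ℕ × ℕ => (Nat.pair x.1 x.2, 0))
      ((Primrec₂.natPair.comp Primrec.fst Primrec.snd).pair (Primrec.const 0))
    have h2 := (((ihf.comp (f := fun x : ((ℕ × ℕ) × ℕ) × ℕ => (Nat.pair x.1.1.1 x.1.2, x.2))
      ((Primrec₂.natPair.comp (Primrec.fst.comp (Primrec.fst.comp Primrec.fst))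
        (Primrec.snd.comp Primrec.fst)).pair Primrec.snd)).and (EnumIn.of_primrecPred
        (Primrec.eq.comp Primrec.snd (Primrec.const 0)).not)).exists).forall_lt
        (f := fun x : ℕ × ℕ => x.2) Primrec.snd
    refine (h1.and h2).of_eq ?_
    rintro ⟨a, n⟩
    refine Iff.trans ?_ Nat.mem_rfind.symm
    simp

/-- The set `A` and its complement are enumerable relative to the oracle `q`. -/
def DecidedBy (q : ℕ → ℕ) (A : Set ℕ) : Prop :=
  (EnumIn q fun n => n ∈ A) ∧ EnumIn q fun n => n ∉ A

theorem SetTuringLE.decidedBy {A B : Set ℕ} (h : SetTuringLE A B) : DecidedBy (charFun B) A := by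
  have hg := enumIn_graph_of_recursiveIn (RecursiveIn.iff_nat.1 h)
  refine ⟨(hg.comp (f := fun n : ℕ => (n, 1)) (Primrec.id.pair (Primrec.const 1))).of_eq ?_,
    (hg.comp (f := fun n : ℕ => (n, 0)) (Primrec.id.pair (Primrec.const 0))).of_eq ?_⟩ <;>
  · intro n
    by_cases hn : n ∈ A <;> simp [charFun, hn]

/-- A computation uses finitely many values of `g`; these are guessed as a list and confirmed by
enumerating the graph of `g` from `q`. -/
theorem EnumIn.trans {W : α → Prop} (hW : EnumIn g W) {q : ℕ → ℕ}
    (hg : EnumIn q fun x : ℕ × ℕ => g x.1 = x.2) : EnumIn q W := by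
  obtain ⟨U, ⟨E, hE, hUE⟩, hWU⟩ := hW
  have h1 : EnumIn q fun x : (α × List ℕ) × ℕ => g x.2 = x.1.2.getD x.2 0 :=
    hg.comp (f := fun x : (α × List ℕ) × ℕ => (x.2, x.1.2.getD x.2 0)) <|
      Primrec.snd.pair ((Primrec.list_getD 0).comp (Primrec.snd.comp Primrec.fst) Primrec.snd)
  have h2 := h1.forall_lt (f := fun x : α × List ℕ => x.2.length)
    (Primrec.list_length.comp Primrec.snd)
  refine ((EnumIn.of_primrecPred hE).and h2).exists.of_eq fun a => ?_
  rw [hWU, hUE]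
  constructor
  · rintro ⟨l, hl, h⟩
    refine ⟨l.length, ?_⟩
    convert hl
    apply List.ext_getElem (by simp)
    intro i h1 h2
    simpa [List.getD_eq_getElem?_getD, h2] using h i h2
  · rintro ⟨n, hn⟩
    refine ⟨_, hn, fun i hi => ?_⟩
    simp at hi
    simp [List.getD_eq_getElem?_getD, hi]

/-- The set `C` is not computable from the oracle `p`. -/
def Avoids (C : Set ℕ) (p : ℕ → ℕ) : Prop :=
  ¬DecidedBy p C

theorem Avoids.of_enumIn_graph {C : Set ℕ} {p q : ℕ → ℕ} (h : Avoids C p)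
    (hq : EnumIn p fun x : ℕ × ℕ => q x.1 = x.2) : Avoids C q :=
  fun hC => h ⟨hC.1.trans hq, hC.2.trans hq⟩

theorem DecidedBy.enumIn_graph {A : Set ℕ} {q : ℕ → ℕ} (h : DecidedBy q A) :
    EnumIn q fun x : ℕ × ℕ => charFun A x.1 = x.2 := by
  have hx (k : ℕ) : EnumIn q fun x : ℕ × ℕ => x.2 = k :=
    EnumIn.of_primrecPred (Primrec.eq.comp Primrec.snd (Primrec.const k))
  refine (((h.1.comp Primrec.fst).and (hx 1)).or ((h.2.comp Primrec.fst).and (hx 0))).of_eq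
    fun x => ?_
  by_cases hA : x.1 ∈ A <;> simp [charFun, hA, eq_comm]

theorem Avoids.not_setTuringLE {C G : Set ℕ} (h : Avoids C (charFun G)) : ¬SetTuringLE C G :=
  fun hC => h hC.decidedBy

/-- Prefixes of the zero oracle are primitive recursive, so enumerability from it is recursive
enumerability, and Post's theorem applies. -/
theorem avoids_charFun_empty {C : Set ℕ} (hC : ¬ComputablePred fun n => n ∈ C) :
    Avoids C (charFun ∅) := by
  have key : ∀ W : ℕ → Prop, EnumIn (charFun ∅) W → REPred W := by
    classical
    rintro W ⟨U, ⟨E, hE, hUE⟩, hW⟩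
    have hp : Primrec fun n => oraclePrefix (charFun ∅) n := by
      refine (Primrec.list_map Primrec.list_range (Primrec₂.const 0)).of_eq fun n => ?_
      simp [oraclePrefix, charFun]
    have hc : Computable₂ fun (a n : ℕ) => decide (E a (oraclePrefix (charFun ∅) n)) :=
      (PrimrecRel.comp hE Primrec.fst (hp.comp Primrec.snd)).decide.to_comp
    refine (Partrec.rfind hc.partrec₂).dom_re.of_eq fun a => ?_
    rw [hW, hUE, Nat.rfind_dom]
    simp
  exact fun h => hC (ComputablePred.computable_iff_re_compl_re'.2 ⟨key _ h.1, key _ h.2⟩)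

end Enumerable

/-! ### Quantifiers over sequences, and oracles obtained value by value -/

section Sequences

variable {α σ τ υ : Type*} [Primcodable α] [Primcodable σ] [Primcodable τ] [Primcodable υ]

/-- The oracle that records `p` and the sequence `X`. -/
def oracleJoin (p : ℕ → ℕ) (X : ℕ → σ) : ℕ → ℕ :=
  fun n => Nat.pair (p n) (encode (X n))

theorem isOpen_iff_prefix {σ : Type*} [TopologicalSpace σ] [DiscreteTopology σ] {S : Set (ℕ → σ)} :
    IsOpen S ↔ ∀ X ∈ S, ∃ n, ∀ X' : ℕ → σ, (∀ i < n, X' i = X i) → X' ∈ S := by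
  have hb := PiNat.isTopologicalBasis_cylinders (fun _ : ℕ => σ)
  constructor
  · intro h X hX
    obtain ⟨_, ⟨Y, n, rfl⟩, hXY, hS⟩ := hb.exists_subset_of_mem_open hX h
    exact ⟨n, fun X' hX' => hS fun i hi => (hX' i hi).trans (hXY i hi)⟩
  · intro h
    refine isOpen_iff_forall_mem_open.2 fun X hX => ?_
    obtain ⟨n, hn⟩ := h X hX
    exact ⟨PiNat.cylinder X n, fun X' hX' => hn X' hX', PiNat.isOpen_cylinder _ _ _,
      PiNat.self_mem_cylinder _ _⟩

theorem EffOpen.exists_prefix_forall {U : α → (ℕ → ℕ) → Prop} (hU : EffOpen U) {a : α} {p : ℕ → ℕ}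
    (h : U a p) : ∃ n, ∀ q : ℕ → ℕ, (∀ i < n, q i = p i) → U a q := by
  obtain ⟨E, hE, hUE⟩ := hU
  obtain ⟨n, hn⟩ := (hUE _ _).1 h
  exact ⟨n, fun q hq => (hUE _ _).2 ⟨n, by rwa [oraclePrefix_congr hq]⟩⟩

/-- The finite strings that record a given finite string of oracle values together with an
arbitrary string over the finite type `σ` of the same length. -/
def joinExtensions (codes : List ℕ) (l : List ℕ) : List (List ℕ) :=
  l.foldl (fun acc d => acc.flatMap fun t => codes.map fun c => t ++ [Nat.pair d c]) [[]]

theorem primrec_joinExtensions (codes : List ℕ) : Primrec (joinExtensions codes) := by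
  refine Primrec.list_foldl (h := fun (_ : List ℕ) (s : List (List ℕ) × ℕ) =>
    s.1.flatMap fun t => codes.map fun c => t ++ [Nat.pair s.2 c]) Primrec.id
    (Primrec.const ([[]] : List (List ℕ))) ?_
  refine Primrec.list_flatMap (f := fun x : List ℕ × (List (List ℕ) × ℕ) => x.2.1)
    (g := fun x t => codes.map fun c => t ++ [Nat.pair x.2.2 c])
    (Primrec.fst.comp Primrec.snd) ?_
  refine Primrec.list_map
    (f := fun _ : (List ℕ × (List (List ℕ) × ℕ)) × List ℕ => codes)
    (g := fun x c => x.2 ++ [Nat.pair x.1.2.2 c]) (Primrec.const codes) ?_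
  exact Primrec.list_append.comp (Primrec.snd.comp Primrec.fst)
    (Primrec.list_cons.comp (Primrec₂.natPair.comp
      (Primrec.snd.comp (Primrec.snd.comp (Primrec.fst.comp Primrec.fst))) Primrec.snd)
      (Primrec.const []))

theorem mem_joinExtensions [Inhabited σ] {codes : List ℕ}
    (hcodes : ∀ c, c ∈ codes ↔ ∃ x : σ, encode x = c) (p : ℕ → ℕ) (n : ℕ) (t : List ℕ) :
    t ∈ joinExtensions codes (oraclePrefix p n) ↔
      ∃ X : ℕ → σ, t = oraclePrefix (oracleJoin p X) n := by
  induction n generalizing t with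
  | zero => simp [joinExtensions, oraclePrefix]
  | succ n ih =>
    have e1 : ∀ q : ℕ → ℕ, oraclePrefix q (n + 1) = oraclePrefix q n ++ [q n] := fun q => by
      simp [oraclePrefix, List.range_succ]
    have e2 : joinExtensions codes (oraclePrefix p (n + 1)) =
        (joinExtensions codes (oraclePrefix p n)).flatMap
          fun t => codes.map fun c => t ++ [Nat.pair (p n) c] := by
      rw [e1, joinExtensions, List.foldl_append]; rfl
    rw [e2]
    simp only [List.mem_flatMap, List.mem_map, ih]
    constructor
    · rintro ⟨_, ⟨X, rfl⟩, c, hc, rfl⟩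
      obtain ⟨x, rfl⟩ := (hcodes c).1 hc
      refine ⟨Function.update X n x, ?_⟩
      rw [e1]
      congr 1
      · refine oraclePrefix_congr fun i hi => ?_
        simp [oracleJoin, Function.update_of_ne hi.ne]
      · simp [oracleJoin]
    · rintro ⟨X, rfl⟩
      exact ⟨_, ⟨X, rfl⟩, encode (X n), (hcodes _).2 ⟨_, rfl⟩, (e1 _).symm⟩

/-- Effectively open relations are closed under universal quantification over a compact space of
sequences. -/
theorem EffOpen.forall_seq [Finite σ] [Inhabited σ] {U : α → (ℕ → ℕ) → Prop} (hU : EffOpen U) :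
    EffOpen fun a p => ∀ X : ℕ → σ, U a (oracleJoin p X) := by
  obtain ⟨E, hE, mE, hUE⟩ := hU.exists_monotone
  have : Fintype σ := Fintype.ofFinite σ
  let codes : List ℕ := (Finset.univ : Finset σ).toList.map encode
  have hcodes : ∀ c, c ∈ codes ↔ ∃ x : σ, encode x = c := fun c => by simp [codes]
  refine ⟨fun a l => ∀ t ∈ joinExtensions codes l, E a t, ?_, fun a p => ?_⟩
  · refine PrimrecPred.comp (p := fun x : List (List ℕ) × α => ∀ t ∈ x.1, E x.2 t)
      (f := fun x : α × List ℕ => (joinExtensions codes x.2, x.1)) ?_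
      (((primrec_joinExtensions codes).comp Primrec.snd).pair Primrec.fst)
    exact PrimrecRel.forall_mem_list (R := fun t a => E a t) (hE.comp Primrec.snd Primrec.fst)
  · simp only [mem_joinExtensions hcodes, hUE]
    constructor
    · intro h
      let _ : TopologicalSpace σ := ⊥
      have : DiscreteTopology σ := ⟨rfl⟩
      have hopen : ∀ n, IsOpen {X : ℕ → σ | E a (oraclePrefix (oracleJoin p X) n)} := fun n => by
        refine isOpen_iff_prefix.2 fun X hX => ⟨n, fun X' hX' => ?_⟩
        have : oraclePrefix (oracleJoin p X') n = oraclePrefix (oracleJoin p X) n :=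
          oraclePrefix_congr fun i hi => by simp [oracleJoin, hX' i hi]
        simpa [this] using hX
      -- The sets of sequences accepted by stage `n` are open and increase with `n`, so by
      -- compactness one stage accepts all sequences.
      obtain ⟨n, hn⟩ := isCompact_univ.elim_directed_cover _ hopen
        (fun X _ => Set.mem_iUnion.2 (h X)) (directed_of_isDirected_le fun m n hmn X hX =>
          mE _ _ _ (oraclePrefix_prefix _ hmn) hX)
      exact ⟨n, by rintro t ⟨X, rfl⟩; exact hn (Set.mem_univ X)⟩
    · rintro ⟨n, hn⟩ X
      exact ⟨n, hn _ ⟨X, rfl⟩⟩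

/-- By openness a witness may be replaced by a sequence that is eventually `default`, so the
quantifier ranges over finite lists. -/
theorem EffOpen.exists_seq [Inhabited σ] {U : α → (ℕ → ℕ) → Prop} (hU : EffOpen U) :
    EffOpen fun a p => ∃ X : ℕ → σ, U a (oracleJoin p X) := by
  have hΓ : EffOpen fun (x : ((α × List σ) × ℕ) × ℕ) p =>
      oracleJoin p (fun n => x.1.1.2.getD n default) x.1.2 = x.2 := by
    have h1 : EffOpen fun (x : (((α × List σ) × ℕ) × ℕ) × ℕ) p => p x.1.1.2 = x.2 :=
      effOpen_apply.comp (f := fun x : (((α × List σ) × ℕ) × ℕ) × ℕ => (x.1.1.2, x.2))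
        ((Primrec.snd.comp (Primrec.fst.comp Primrec.fst)).pair Primrec.snd)
    have h2 : PrimrecPred fun (x : (((α × List σ) × ℕ) × ℕ) × ℕ) =>
        Nat.pair x.2 (encode (x.1.1.1.2.getD x.1.1.2 default)) = x.1.2 :=
      Primrec.eq.comp (Primrec₂.natPair.comp Primrec.snd (Primrec.encode.comp
        ((Primrec.list_getD default).comp
          (Primrec.snd.comp (Primrec.fst.comp (Primrec.fst.comp Primrec.fst)))
          (Primrec.snd.comp (Primrec.fst.comp Primrec.fst))))) (Primrec.snd.comp Primrec.fst)
    exact (h1.and (EffOpen.of_primrecPred h2)).exists.of_eq fun x p => by simp [oracleJoin]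
  have hU' : EffOpen fun (x : α × List σ) p => U x.1 p := hU.comp Primrec.fst
  refine (hU'.subst (Γ := fun (x : α × List σ) p => oracleJoin p fun n => x.2.getD n default)
    hΓ).exists.of_eq fun a p => ⟨fun ⟨l, hl⟩ => ⟨_, hl⟩, fun ⟨X, hX⟩ => ?_⟩
  obtain ⟨n, hn⟩ := hU.exists_prefix_forall hX
  refine ⟨(List.range n).map X, hn _ fun i hi => ?_⟩
  simp [oracleJoin, List.getD_eq_getElem?_getD, hi]

variable {ι κ : Type*}

/-- The sequence `X i` is obtained from the oracle `P i` value by value, uniformly in `i`. -/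
def Pointwise (P : ι → ℕ → ℕ) (X : ι → ℕ → σ) : Prop :=
  ∃ c : ℕ → ℕ → σ, Primrec₂ c ∧ ∀ i n, X i n = c n (P i n)

theorem Pointwise.refl (P : ι → ℕ → ℕ) : Pointwise P P :=
  ⟨fun _ y => y, Primrec₂.right, fun _ _ => rfl⟩

theorem Pointwise.trans {P Q : ι → ℕ → ℕ} {X : ι → ℕ → σ} (h : Pointwise P Q)
    (h' : Pointwise Q X) : Pointwise P X := by
  obtain ⟨c, hc, h⟩ := h
  obtain ⟨d, hd, h'⟩ := h'
  exact ⟨fun n y => d n (c n y), hd.comp₂ Primrec₂.left hc, fun i n => by rw [h', h]⟩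

theorem Pointwise.map {P : ι → ℕ → ℕ} {X : ι → ℕ → σ} (h : Pointwise P X) {f : ℕ → σ → τ}
    (hf : Primrec₂ f) : Pointwise P fun i n => f n (X i n) := by
  obtain ⟨c, hc, h⟩ := h
  exact ⟨fun n y => f n (c n y), hf.comp₂ Primrec₂.left hc, fun i n => by simp only [h]⟩

theorem Pointwise.map₂ {P : ι → ℕ → ℕ} {X : ι → ℕ → σ} {Y : ι → ℕ → τ} (h : Pointwise P X)
    (h' : Pointwise P Y) {f : σ → τ → υ} (hf : Primrec₂ f) :
    Pointwise P fun i n => f (X i n) (Y i n) := by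
  obtain ⟨c, hc, h⟩ := h
  obtain ⟨d, hd, h'⟩ := h'
  exact ⟨fun n y => f (c n y) (d n y), hf.comp₂ hc hd, fun i n => by simp only [h, h']⟩

theorem Pointwise.join {P Q : ι → ℕ → ℕ} {X : ι → ℕ → σ} (h : Pointwise P Q)
    (h' : Pointwise P X) : Pointwise P fun i => oracleJoin (Q i) (X i) :=
  h.map₂ h' (f := fun y x => Nat.pair y (encode x))
    (Primrec₂.natPair.comp₂ Primrec₂.left (Primrec.encode.comp₂ Primrec₂.right))

theorem Pointwise.reindex {P : ι → ℕ → ℕ} {X : ι → ℕ → σ} (h : Pointwise P X) (g : κ → ι) :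
    Pointwise (fun k => P (g k)) fun k => X (g k) := by
  obtain ⟨c, hc, h⟩ := h
  exact ⟨c, hc, fun k n => h (g k) n⟩

theorem pointwise_join_left (P : ι → ℕ → ℕ) (X : ι → ℕ → σ) :
    Pointwise (fun i => oracleJoin (P i) (X i)) P :=
  ⟨fun _ y => y.unpair.1, (Primrec.fst.comp Primrec.unpair).comp₂ Primrec₂.right,
    fun i n => by simp [oracleJoin]⟩

theorem pointwise_join_right [Inhabited σ] (P : ι → ℕ → ℕ) (X : ι → ℕ → σ) :
    Pointwise (fun i => oracleJoin (P i) (X i)) X := by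
  refine ⟨fun _ y => (decode y.unpair.2).getD default, ?_, fun i n => by simp [oracleJoin]⟩
  exact (Primrec.option_getD_default.comp (Primrec.decode.comp
    (Primrec.snd.comp Primrec.unpair))).comp₂ Primrec₂.right

theorem Pointwise.join_of_left {P : ι → ℕ → ℕ} {X : ι → ℕ → σ} (Y : ι → ℕ → τ)
    (h : Pointwise P X) : Pointwise (fun i => oracleJoin (P i) (Y i)) X :=
  (pointwise_join_left P Y).trans h

/-- The property `W` of `i` is effectively open in the oracle `P i`. -/
def RelOpen (P : ι → ℕ → ℕ) (W : ι → Prop) : Prop :=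
  ∃ U : Unit → (ℕ → ℕ) → Prop, EffOpen U ∧ ∀ i, W i ↔ U () (P i)

theorem RelOpen.of_eq {P : ι → ℕ → ℕ} {V W : ι → Prop} (hV : RelOpen P V)
    (h : ∀ i, V i ↔ W i) : RelOpen P W := by
  have : V = W := by ext i; exact h i
  exact this ▸ hV

theorem RelOpen.or {P : ι → ℕ → ℕ} {V W : ι → Prop} (hV : RelOpen P V) (hW : RelOpen P W) :
    RelOpen P fun i => V i ∨ W i := by
  obtain ⟨U, hU, h⟩ := hV
  obtain ⟨U', hU', h'⟩ := hW
  exact ⟨_, hU.or hU', fun i => or_congr (h i) (h' i)⟩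

theorem RelOpen.reindex {P : ι → ℕ → ℕ} {W : ι → Prop} (h : RelOpen P W) (g : κ → ι) :
    RelOpen (fun k => P (g k)) fun k => W (g k) := by
  obtain ⟨U, hU, h⟩ := h
  exact ⟨U, hU, fun k => h (g k)⟩

theorem effOpen_pointwise {c : ℕ → ℕ → ℕ} (hc : Primrec₂ c) :
    EffOpen fun (x : ℕ × ℕ) p => c x.1 (p x.1) = x.2 := by
  have h1 : EffOpen fun (x : (ℕ × ℕ) × ℕ) p => p x.1.1 = x.2 :=
    effOpen_apply.comp (f := fun x : (ℕ × ℕ) × ℕ => (x.1.1, x.2))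
      ((Primrec.fst.comp Primrec.fst).pair Primrec.snd)
  have h2 : PrimrecPred fun (x : (ℕ × ℕ) × ℕ) => c x.1.1 x.2 = x.1.2 :=
    Primrec.eq.comp (hc.comp (Primrec.fst.comp Primrec.fst) Primrec.snd)
      (Primrec.snd.comp Primrec.fst)
  exact (h1.and (EffOpen.of_primrecPred h2)).exists.of_eq fun x p => by simp

theorem EffOpen.subst_pointwise {U : α → (ℕ → ℕ) → Prop} (hU : EffOpen U) {c : ℕ → ℕ → ℕ}
    (hc : Primrec₂ c) : EffOpen fun a p => U a fun n => c n (p n) :=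
  hU.subst (Γ := fun _ p n => c n (p n)) <|
    (effOpen_pointwise hc).comp (f := fun x : (α × ℕ) × ℕ => (x.1.2, x.2))
      ((Primrec.snd.comp Primrec.fst).pair Primrec.snd)

theorem RelOpen.mono {P Q : ι → ℕ → ℕ} {W : ι → Prop} (hW : RelOpen Q W) (h : Pointwise P Q) :
    RelOpen P W := by
  obtain ⟨U, hU, hW⟩ := hW
  obtain ⟨c, hc, h⟩ := h
  refine ⟨_, hU.subst_pointwise hc, fun i => ?_⟩
  rw [hW, show Q i = fun n => c n (P i n) from funext (h i)]

theorem RelOpen.exists_nat {P : ι → ℕ → ℕ} {X : ι → ℕ → σ} (h : Pointwise P X)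
    {S : σ → Prop} (hS : PrimrecPred S) : RelOpen P fun i => ∃ n, S (X i n) := by
  obtain ⟨c, hc, h⟩ := h
  refine ⟨fun _ p => ∃ b : ℕ × ℕ, p b.1 = b.2 ∧ S (c b.1 b.2), ?_, fun i => ?_⟩
  · refine EffOpen.exists (U := fun (x : Unit × (ℕ × ℕ)) p => p x.2.1 = x.2.2 ∧
      S (c x.2.1 x.2.2)) ?_
    exact (effOpen_apply.comp Primrec.snd).and (EffOpen.of_primrecPred
      (hS.comp (hc.comp (Primrec.fst.comp Primrec.snd) (Primrec.snd.comp Primrec.snd))))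
  · simp [h]

theorem RelOpen.forall_seq [Finite σ] [Inhabited σ] {P : ι → ℕ → ℕ} {W : ι × (ℕ → σ) → Prop}
    (h : RelOpen (fun x : ι × (ℕ → σ) => oracleJoin (P x.1) x.2) W) :
    RelOpen P fun i => ∀ X, W (i, X) := by
  obtain ⟨U, hU, h⟩ := h
  exact ⟨_, hU.forall_seq (σ := σ), fun i => forall_congr' fun X => h (i, X)⟩

theorem RelOpen.exists_seq [Inhabited σ] {P : ι → ℕ → ℕ} {W : ι × (ℕ → σ) → Prop}
    (h : RelOpen (fun x : ι × (ℕ → σ) => oracleJoin (P x.1) x.2) W) :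
    RelOpen P fun i => ∃ X, W (i, X) := by
  obtain ⟨U, hU, h⟩ := h
  exact ⟨_, hU.exists_seq (σ := σ), fun i => exists_congr fun X => h (i, X)⟩

theorem EffOpen.isOpen_join [TopologicalSpace σ] [DiscreteTopology σ] {U : α → (ℕ → ℕ) → Prop}
    (hU : EffOpen U) (a : α) (p : ℕ → ℕ) : IsOpen {X : ℕ → σ | U a (oracleJoin p X)} := by
  refine isOpen_iff_prefix.2 fun X hX => ?_
  obtain ⟨n, hn⟩ := hU.exists_prefix_forall hX
  exact ⟨n, fun X' hX' => hn _ fun i hi => by simp [oracleJoin, hX' i hi]⟩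

theorem RelOpen.isOpen [TopologicalSpace σ] [DiscreteTopology σ] {p : ℕ → ℕ}
    {W : (ℕ → σ) → Prop} (h : RelOpen (fun X => oracleJoin p X) W) : IsOpen {X | W X} := by
  obtain ⟨U, hU, h⟩ := h
  simpa only [h] using hU.isOpen_join () p

theorem Pointwise.enumIn_graph {q : ℕ → ℕ} {X : ℕ → σ}
    (h : Pointwise (fun _ : Unit => q) fun _ => X) : EnumIn q fun x : ℕ × σ => X x.1 = x.2 := by
  obtain ⟨c, hc, h⟩ := h
  have h1 : EnumIn q fun x : (ℕ × σ) × ℕ => q x.1.1 = x.2 :=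
    ⟨_, effOpen_apply.comp (f := fun x : (ℕ × σ) × ℕ => (x.1.1, x.2))
      ((Primrec.fst.comp Primrec.fst).pair Primrec.snd), fun _ => Iff.rfl⟩
  have h2 : EnumIn q fun x : (ℕ × σ) × ℕ => c x.1.1 x.2 = x.1.2 :=
    EnumIn.of_primrecPred (Primrec.eq.comp (hc.comp (Primrec.fst.comp Primrec.fst) Primrec.snd)
      (Primrec.snd.comp Primrec.fst))
  have h' : ∀ n, X n = c n (q n) := h ()
  exact (h1.and h2).exists.of_eq fun x => by simp [h']

theorem Avoids.mono {C : Set ℕ} {p q : ℕ → ℕ} (h : Avoids C p)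
    (hpq : Pointwise (fun _ : Unit => p) fun _ => q) : Avoids C q :=
  h.of_enumIn_graph hpq.enumIn_graph

end Sequences

/-! ### Finite modifications, the basis theorem and Baire category -/

section Genericity

variable {σ : Type*}

/-- The sequence `X` with its first values replaced by the string `L`. -/
def splice (L : List σ) (X : ℕ → σ) : ℕ → σ :=
  fun n => L[n]?.getD (X n)

theorem splice_of_lt {L : List σ} {n : ℕ} (h : n < L.length) (X : ℕ → σ) :
    splice L X n = L[n] := by
  simp [splice, h]

theorem splice_of_le {L : List σ} {n : ℕ} (h : L.length ≤ n) (X : ℕ → σ) :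
    splice L X n = X n := by
  simp [splice, h]

/-- The string of the first `n` values of a sequence. -/
def seqPrefix (X : ℕ → σ) (n : ℕ) : List σ :=
  (List.range n).map X

@[simp] theorem length_seqPrefix (X : ℕ → σ) (n : ℕ) : (seqPrefix X n).length = n := by
  simp [seqPrefix]

theorem splice_seqPrefix_of_lt (X Y : ℕ → σ) {i n : ℕ} (h : i < n) :
    splice (seqPrefix X n) Y i = X i := by
  simp [splice, seqPrefix, h]

theorem splice_seqPrefix_of_le (X Y : ℕ → σ) {i n : ℕ} (h : n ≤ i) :
    splice (seqPrefix X n) Y i = Y i :=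
  splice_of_le (by simpa using h) Y

theorem splice_seqPrefix_self {X Y : ℕ → σ} {n : ℕ} (h : ∀ i, n ≤ i → X i = Y i) :
    splice (seqPrefix X n) Y = X := by
  ext1 i
  rcases lt_or_ge i n with hi | hi
  · exact splice_seqPrefix_of_lt X Y hi
  · rw [splice_seqPrefix_of_le X Y hi, h i hi]

section Topology

variable [TopologicalSpace σ] [DiscreteTopology σ]

theorem isOpen_range_splice (L : List σ) : IsOpen (Set.range (splice L)) := by
  refine isOpen_iff_prefix.2 ?_
  rintro _ ⟨X, rfl⟩
  refine ⟨L.length, fun X' hX' => ⟨X', ?_⟩⟩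
  ext1 i
  rcases lt_or_ge i L.length with h | h
  · rw [hX' i h, splice_of_lt h, splice_of_lt h]
  · rw [splice_of_le h]

theorem dense_iff_splice [Nonempty σ] {S : Set (ℕ → σ)} :
    Dense S ↔ ∀ L, ∃ X, splice L X ∈ S := by
  constructor
  · intro h L
    obtain ⟨_, ⟨X, rfl⟩, hS⟩ := h.inter_open_nonempty _ (isOpen_range_splice L)
      (Set.range_nonempty _)
    exact ⟨X, hS⟩
  · intro h
    refine dense_iff_inter_open.2 fun V hV ⟨X, hX⟩ => ?_
    obtain ⟨n, hn⟩ := isOpen_iff_prefix.1 hV X hX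
    obtain ⟨X', hX'⟩ := h (seqPrefix X n)
    exact ⟨_, hn _ fun i hi => splice_seqPrefix_of_lt X X' hi, hX'⟩

theorem IsOpen.preimage_splice {S : Set (ℕ → σ)} (hS : IsOpen S) (L : List σ) :
    IsOpen (splice L ⁻¹' S) := by
  refine isOpen_iff_prefix.2 fun X hX => ?_
  obtain ⟨n, hn⟩ := isOpen_iff_prefix.1 hS _ hX
  refine ⟨n, fun X' hX' => hn _ fun i hi => ?_⟩
  simp [splice, hX' i hi]

/-- To meet the preimage beyond `M`, density is applied to a prefix long enough to cover both `L`
and `M`, where `L` overrides `M`. -/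
theorem Dense.preimage_splice [Nonempty σ] {S : Set (ℕ → σ)} (hS : Dense S) (L : List σ) :
    Dense (splice L ⁻¹' S) := by
  refine dense_iff_splice.2 fun M => ?_
  let n := max L.length M.length
  obtain ⟨A⟩ : Nonempty (ℕ → σ) := inferInstance
  obtain ⟨X, hX⟩ := dense_iff_splice.1 hS (seqPrefix (splice L (splice M A)) n)
  refine ⟨X, ?_⟩
  have hn : L.length ≤ n ∧ M.length ≤ n := ⟨le_max_left _ _, le_max_right _ _⟩
  suffices splice L (splice M X) = splice (seqPrefix (splice L (splice M A)) n) X by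
    rwa [Set.mem_preimage, this]
  ext1 i
  rcases lt_or_ge i n with hi | hi
  · rw [splice_seqPrefix_of_lt _ _ hi]
    rcases lt_or_ge i L.length with h | h
    · rw [splice_of_lt h, splice_of_lt h]
    · have h' : i < M.length := (lt_max_iff.1 hi).resolve_left h.not_gt
      rw [splice_of_le h, splice_of_le h, splice_of_lt h', splice_of_lt h']
  · rw [splice_seqPrefix_of_le _ _ hi, splice_of_le (hn.1.trans hi), splice_of_le (hn.2.trans hi)]

end Topology

variable [Primcodable σ]

theorem Pointwise.splice {ι : Type*} {P : ι → ℕ → ℕ} {X : ι → ℕ → σ} (h : Pointwise P X)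
    (L : List σ) : Pointwise P fun i => splice L (X i) :=
  h.map (f := fun n x => L[n]?.getD x) <|
    Primrec.option_getD.comp ((Primrec.list_getElem?₁ L).comp Primrec.fst) Primrec.snd

variable [Inhabited σ] {C : Set ℕ} {p : ℕ → ℕ}

/-- The enumerations `U` and `U'` do not compute `C` from the oracle `q`. -/
def Misses (C : Set ℕ) (U U' : ℕ → (ℕ → ℕ) → Prop) (q : ℕ → ℕ) : Prop :=
  ¬∀ x, (x ∈ C ↔ U x q) ∧ (x ∉ C ↔ U' x q)

theorem avoids_of_forall_misses {q : ℕ → ℕ}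
    (h : ∀ U U', EffOpen U → EffOpen U' → Misses C U U' q) : Avoids C q :=
  fun ⟨⟨U, hU, h1⟩, U', hU', h2⟩ => h U U' hU hU' fun x => ⟨h1 x, h2 x⟩

/-- If some member of `S` fails to enumerate a required number into `C` or into its complement,
restricting `S` to such members keeps it effectively closed. Otherwise no member computes `C`
through `U` and `U'`: if one did, `x ∈ C` would hold exactly when every `X` lies outside `S` or
satisfies `U x`, and likewise for the complement, so `p` would decide `C`. -/
theorem exists_subclass_misses [Finite σ] (hp : Avoids C p) {S : (ℕ → σ) → Prop}
    (hS : RelOpen (fun X => oracleJoin p X) fun X => ¬S X) (hne : ∃ X, S X)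
    {U U' : ℕ → (ℕ → ℕ) → Prop} (hU : EffOpen U) (hU' : EffOpen U') :
    ∃ S' : (ℕ → σ) → Prop, (RelOpen (fun X => oracleJoin p X) fun X => ¬S' X) ∧ (∃ X, S' X) ∧
      ∀ X, S' X → S X ∧ Misses C U U' (oracleJoin p X) := by
  have hfix : ∀ {V : ℕ → (ℕ → ℕ) → Prop}, EffOpen V → ∀ x,
      RelOpen (fun X : ℕ → σ => oracleJoin p X) fun X => ¬(S X ∧ ¬V x (oracleJoin p X)) := by
    intro V hV x
    refine (hS.or ⟨_, hV.comp (Primrec.const x), fun X => Iff.rfl⟩).of_eq fun X => ?_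
    tauto
  by_cases h1 : ∃ x ∈ C, ∃ X, S X ∧ ¬U x (oracleJoin p X)
  · obtain ⟨x, hx, h⟩ := h1
    exact ⟨_, hfix hU x, h, fun X hX => ⟨hX.1, fun hall => hX.2 ((hall x).1.1 hx)⟩⟩
  by_cases h2 : ∃ x ∉ C, ∃ X, S X ∧ ¬U' x (oracleJoin p X)
  · obtain ⟨x, hx, h⟩ := h2
    exact ⟨_, hfix hU' x, h, fun X hX => ⟨hX.1, fun hall => hX.2 ((hall x).2.1 hx)⟩⟩
  refine ⟨S, hS, hne, fun X hX => ⟨hX, fun hall => hp ?_⟩⟩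
  push Not at h1 h2
  obtain ⟨V, hV, hSV⟩ := hS
  have hV' : EffOpen fun (_ : ℕ) p => V () p := hV.comp (Primrec.const ())
  refine ⟨⟨_, (hV'.or hU).forall_seq (σ := σ), fun x => ?_⟩,
    ⟨_, (hV'.or hU').forall_seq (σ := σ), fun x => ?_⟩⟩
  · simp only [← hSV]
    exact ⟨fun hx Y => or_iff_not_imp_left.2 fun hY => h1 x hx Y (not_not.1 hY),
      fun h => (hall x).1.2 ((h X).resolve_left (not_not.2 hX))⟩
  · simp only [← hSV]
    exact ⟨fun hx Y => or_iff_not_imp_left.2 fun hY => h2 x hx Y (not_not.1 hY),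
      fun h => (hall x).2.2 ((h X).resolve_left (not_not.2 hX))⟩

theorem exists_nat_enum_effOpen :
    ∃ e : ℕ → {U : ℕ → (ℕ → ℕ) → Prop // EffOpen U} × {U : ℕ → (ℕ → ℕ) → Prop // EffOpen U},
      Function.Surjective e := by
  have : Nonempty {U : ℕ → (ℕ → ℕ) → Prop // EffOpen U} :=
    ⟨⟨_, EffOpen.of_primrecPred (P := fun a : ℕ => a = a) (Primrec.eq.comp Primrec.id Primrec.id)⟩⟩
  exact exists_surjective_nat _

/-- The cone avoidance basis theorem. -/
theorem exists_mem_avoids [Finite σ] (hp : Avoids C p) {S : (ℕ → σ) → Prop}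
    (hS : RelOpen (fun X => oracleJoin p X) fun X => ¬S X) (hne : ∃ X, S X) :
    ∃ X, S X ∧ Avoids C (oracleJoin p X) := by
  let _ : TopologicalSpace σ := ⊥
  have : DiscreteTopology σ := ⟨rfl⟩
  obtain ⟨e, he⟩ := exists_nat_enum_effOpen
  let Cls := {S : (ℕ → σ) → Prop // (RelOpen (fun X => oracleJoin p X) fun X => ¬S X) ∧ ∃ X, S X}
  have step : ∀ (n : ℕ) (S : Cls), ∃ S' : Cls, ∀ X, S'.1 X →
      S.1 X ∧ Misses C (e n).1.1 (e n).2.1 (oracleJoin p X) := by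
    rintro n ⟨S, hS, hne⟩
    obtain ⟨S', h1, h2, h3⟩ := exists_subclass_misses hp hS hne (e n).1.2 (e n).2.2
    exact ⟨⟨S', h1, h2⟩, h3⟩
  choose f hf using step
  -- Nonempty compact classes that decrease have a common point, and stage `n` defeats the `n`-th
  -- pair of enumerations.
  let s : ℕ → Cls := fun n => Nat.rec ⟨S, hS, hne⟩ f n
  have hclosed : ∀ n, IsClosed {X | (s n).1 X} := fun n =>
    ⟨(s n).2.1.isOpen⟩
  obtain ⟨X, hX⟩ := IsCompact.nonempty_iInter_of_sequence_nonempty_isCompact_isClosed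
    (fun n => {X | (s n).1 X}) (fun n X hX => (hf n (s n) X hX).1) (fun n => (s n).2.2)
    (hclosed 0).isCompact hclosed
  rw [Set.mem_iInter] at hX
  refine ⟨X, hX 0, avoids_of_forall_misses fun U U' hU hU' => ?_⟩
  obtain ⟨n, hn⟩ := he (⟨U, hU⟩, ⟨U', hU'⟩)
  have := (hf n (s n) X (hX (n + 1))).2
  rwa [hn] at this

/-- If a cylinder contains no interior point of the set, the sequences from which `U` and `U'` do
compute `C` are dense in it. A number is then in `C` exactly when `U` enumerates it from some
sequence in the cylinder, and similarly for the complement and `U'`, so `p` would decide `C`. -/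
theorem dense_interior_misses [TopologicalSpace σ] [DiscreteTopology σ] (hp : Avoids C p)
    {U U' : ℕ → (ℕ → ℕ) → Prop} (hU : EffOpen U) (hU' : EffOpen U') :
    Dense (interior {X : ℕ → σ | Misses C U U' (oracleJoin p X)}) := by
  refine dense_iff_splice.2 fun L => ?_
  by_contra hcon
  push Not at hcon
  have key : ∀ (V : ℕ → (ℕ → ℕ) → Prop), EffOpen V → ∀ (W : ℕ → Prop),
      (∀ X : ℕ → σ, ¬Misses C U U' (oracleJoin p X) → ∀ x, W x ↔ V x (oracleJoin p X)) →
      EnumIn p W := by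
    intro V hV W hVW
    have hpw : Pointwise (fun x : (ℕ → ℕ) × (ℕ → σ) => oracleJoin x.1 x.2)
        fun x => oracleJoin x.1 (splice L x.2) :=
      (pointwise_join_left _ _).join ((pointwise_join_right _ _).splice L)
    obtain ⟨c, hc, hcx⟩ := hpw
    refine ⟨_, (hV.subst_pointwise hc).exists_seq (σ := σ), fun x => ?_⟩
    have e : ∀ X, (fun n => c n (oracleJoin p X n)) = oracleJoin p (splice L X) :=
      fun X => funext fun n => (hcx (p, X) n).symm
    simp only [e]
    constructor
    · intro hx
      by_contra hall
      push Not at hall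
      refine hcon default (mem_interior.2 ⟨_, ?_, isOpen_range_splice L, ⟨default, rfl⟩⟩)
      rintro _ ⟨X, rfl⟩
      by_contra hX
      exact hall X ((hVW _ hX x).1 hx)
    · rintro ⟨X, hX⟩
      by_contra hx
      refine hcon X (mem_interior.2 ⟨_, ?_, hV.isOpen_join x p, hX⟩)
      intro Y hY
      by_contra hM
      exact hx ((hVW Y hM x).2 hY)
  refine hp ⟨key U hU _ fun X hX x => ?_, key U' hU' _ fun X hX x => ?_⟩
  · exact (not_not.1 hX x).1
  · exact (not_not.1 hX x).2

/-- Sufficiently generic sequences avoid a given cone. -/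
theorem exists_generic_avoids [Finite σ] [TopologicalSpace σ] [DiscreteTopology σ] (hp : Avoids C p)
    {𝒰 : Set (Set (ℕ → σ))} (hc : 𝒰.Countable) (ho : ∀ O ∈ 𝒰, IsOpen O)
    (hd : ∀ O ∈ 𝒰, Dense O) :
    ∃ X : ℕ → σ, (∀ O ∈ 𝒰, X ∈ O) ∧ Avoids C (oracleJoin p X) := by
  let K : {U : ℕ → (ℕ → ℕ) → Prop // EffOpen U} × {U : ℕ → (ℕ → ℕ) → Prop // EffOpen U} →
    Set (ℕ → σ) := fun u => interior {X | Misses C u.1.1 u.2.1 (oracleJoin p X)}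
  have h : Dense (⋂₀ (𝒰 ∪ Set.range K)) := by
    refine dense_sInter_of_isOpen ?_ (hc.union (Set.countable_range K)) ?_
    · rintro O (hO | ⟨u, rfl⟩)
      · exact ho O hO
      · exact isOpen_interior
    · rintro O (hO | ⟨u, rfl⟩)
      · exact hd O hO
      · exact dense_interior_misses hp u.1.2 u.2.2
  obtain ⟨X, hX⟩ := h.nonempty
  refine ⟨X, fun O hO => hX O (Or.inl hO), avoids_of_forall_misses fun U U' hU hU' => ?_⟩
  exact interior_subset (hX _ (Or.inr ⟨(⟨U, hU⟩, ⟨U', hU'⟩), rfl⟩))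

end Genericity

/-! ### Sequences that differ from `V`, and the columns their partners share -/

section CrossConstraint

theorem finitelyCompatible_iff {k : ℕ} {f g : ℕ → Fin k} :
    FinitelyCompatible f g ↔ ∃ n₀, ∀ n, n₀ ≤ n → f n ≠ g n := by
  have e : {n | f n = g n} = ⋃ i, f ⁻¹' {i} ∩ g ⁻¹' {i} := by
    ext n; simp [eq_comm]
  constructor
  · intro h
    have hfin : {n | f n = g n}.Finite := e ▸ Set.finite_iUnion h
    obtain ⟨m, hm⟩ := hfin.bddAbove
    exact ⟨m + 1, fun n hn hfg => absurd (hm hfg) (by omega)⟩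
  · rintro ⟨n₀, h⟩ i
    refine (Set.finite_Iio n₀).subset ?_
    rintro n ⟨hf, hg⟩
    by_contra hn
    exact h n (not_lt.1 hn) (hf.trans hg.symm)

theorem InfinitelyCompatible.symm {k : ℕ} {f g : ℕ → Fin k} (h : InfinitelyCompatible f g) :
    InfinitelyCompatible g f := by
  rw [InfinitelyCompatible, finitelyCompatible_iff] at h ⊢
  simpa only [ne_comm] using h

/-- The sequences that differ everywhere from `V` are the sequences `offset V b`. -/
def offset (V : ℕ → Fin 3) (b : ℕ → Fin 2) : ℕ → Fin 3 :=
  fun n => V n + 1 + (b n).castSucc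

theorem offset_ne (V : ℕ → Fin 3) (b : ℕ → Fin 2) (n : ℕ) : offset V b n ≠ V n := by
  have : ∀ (v : Fin 3) (c : Fin 2), v + 1 + c.castSucc ≠ v := by decide
  exact this _ _

theorem primrecPred_of_finite {α : Type*} [Primcodable α] [Finite α] (S : α → Prop) :
    PrimrecPred S := by
  classical exact ⟨inferInstance, Primrec.dom_finite _⟩

section Pointwise

variable {ι : Type*} {P : ι → ℕ → ℕ}

theorem Pointwise.offset {V : ι → ℕ → Fin 3} {b : ι → ℕ → Fin 2} (hV : Pointwise P V)
    (hb : Pointwise P b) : Pointwise P fun i => offset (V i) (b i) :=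
  hV.map₂ hb (f := fun v c => v + 1 + c.castSucc) (Primrec.dom_finite _)

theorem pointwise_const {σ : Type*} [Primcodable σ] (x : σ) : Pointwise P fun _ _ => x :=
  ⟨fun _ _ => x, Primrec₂.const x, fun _ _ => rfl⟩

end Pointwise

variable {r m : ℕ} {C : Set ℕ} {p : ℕ → ℕ}
  {R : (ℕ → Fin 3) → (ℕ → Fin r → Fin 2) → Prop}

/-- `R` is a `Π⁰₁` class relative to `p`. -/
def IsEffClosed (p : ℕ → ℕ) (R : (ℕ → Fin 3) → (ℕ → Fin r → Fin 2) → Prop) : Prop :=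
  RelOpen (fun x : (ℕ → Fin 3) × (ℕ → Fin r → Fin 2) => oracleJoin (oracleJoin p x.1) x.2)
    fun x => ¬R x.1 x.2

theorem IsEffClosed.relOpen (hR : IsEffClosed p R) {ι : Type*} {P : ι → ℕ → ℕ}
    {X : ι → ℕ → Fin 3} {Y : ι → ℕ → Fin r → Fin 2} (hp : Pointwise P fun _ => p)
    (hX : Pointwise P X) (hY : Pointwise P Y) : RelOpen P fun i => ¬R (X i) (Y i) :=
  (RelOpen.reindex hR fun i => (X i, Y i)).mono ((hp.join hX).join hY)

theorem IsEffClosed.relOpen_fiber (hR : IsEffClosed p R) (e : Fin m → Fin r) {ι : Type*}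
    {P : ι → ℕ → ℕ} {X : ι → ℕ → Fin 3} {Y : ι → ℕ → Fin r → Fin 2} {Z : ι → ℕ → Fin m → Fin 2}
    (hp : Pointwise P fun _ => p) (hX : Pointwise P X) (hY : Pointwise P Y)
    (hZ : Pointwise P Z) :
    RelOpen P fun i => ¬(R (X i) (Y i) ∧ ∀ n k, Y i n (e k) = Z i n k) := by
  refine ((hR.relOpen hp hX hY).or (RelOpen.exists_nat (hY.map₂ hZ Primrec₂.pair)
    (primrecPred_of_finite fun yz => ∃ k, yz.1 (e k) ≠ yz.2 k))).of_eq fun i => ?_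
  simp only [not_and_or, not_forall]

/-- Beyond the string `L`, every sequence that differs from `V` has a partner in `R` whose
columns selected by `e` are the columns of `Z`. -/
def HasCommonColumns (R : (ℕ → Fin 3) → (ℕ → Fin r → Fin 2) → Prop) (e : Fin m → Fin r)
    (L : List (Fin 3)) (V : ℕ → Fin 3) (Z : ℕ → Fin m → Fin 2) : Prop :=
  ∀ b : ℕ → Fin 2, ∃ Y, R (splice L (offset V b)) Y ∧ ∀ n k, Y n (e k) = Z n k

/-- The negation asserts that some `b` has no suitable partner. The quantifier over partners ranges
over a compact space, so it preserves effective openness, and so does the existential one over `b`.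
Hence the relation between `V` and its shared columns is again an input for the induction. -/
theorem IsEffClosed.hasCommonColumns (hR : IsEffClosed p R) (e : Fin m → Fin r)
    (L M : List (Fin 3)) :
    IsEffClosed p fun V Z => HasCommonColumns R e L (splice M V) Z := by
  have h : RelOpen (fun x : (((ℕ → Fin 3) × (ℕ → Fin m → Fin 2)) × (ℕ → Fin 2)) ×
      (ℕ → Fin r → Fin 2) =>
      oracleJoin (oracleJoin (oracleJoin (oracleJoin p x.1.1.1) x.1.1.2) x.1.2) x.2)
      fun x => ¬(R (splice L (offset (splice M x.1.1.1) x.1.2)) x.2 ∧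
        ∀ n k, x.2 n (e k) = x.1.1.2 n k) := by
    refine hR.relOpen_fiber e ?_ ?_ (pointwise_join_right _ _) ?_
    · exact (((pointwise_join_left _ _).join_of_left _).join_of_left _).join_of_left _
    · exact ((((((pointwise_join_right _ _).join_of_left _).join_of_left _).splice M).offset
        (pointwise_join_right _ _)).splice L).join_of_left _
    · exact ((pointwise_join_right _ _).join_of_left _).join_of_left _
  exact h.forall_seq.exists_seq.of_eq fun x => by simp [HasCommonColumns]

theorem IsEffClosed.isOpen_not_exists_hasCommonColumns (hR : IsEffClosed p R)
    (e : Fin m → Fin r) (L : List (Fin 3)) :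
    IsOpen {V | ¬∃ Z, HasCommonColumns R e L V Z} := by
  -- The empty `M` imposes no condition, as `splice [] V` is `V`.
  have h := RelOpen.forall_seq (P := fun V : ℕ → Fin 3 => oracleJoin p V)
    (hR.hasCommonColumns e L [])
  simp only [not_exists]
  exact h.isOpen

theorem IsEffClosed.isOpen_not_exists_columns (hR : IsEffClosed p R)
    (e : Fin m → Fin r) (L : List (Fin 3)) (V : ℕ → Fin 3) (Z : ℕ → Fin m → Fin 2) :
    IsOpen {b | ¬∃ Y, R (splice L (offset V b)) Y ∧ ∀ n k, Y n (e k) = Z n k} := by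
  have h : RelOpen (fun x : (ℕ → Fin 2) × (ℕ → Fin r → Fin 2) =>
      oracleJoin (oracleJoin (oracleJoin (oracleJoin p V) Z) x.1) x.2)
      fun x => ¬(R (splice L (offset V x.1)) x.2 ∧ ∀ n k, x.2 n (e k) = Z n k) := by
    refine hR.relOpen_fiber e ?_ ?_ (pointwise_join_right _ _) ?_
    · exact (((pointwise_join_left _ _).join_of_left _).join_of_left _).join_of_left _
    · exact (((((pointwise_join_right _ _).join_of_left _).join_of_left _).offset
        (pointwise_join_right _ _)).splice L).join_of_left _
    · exact ((pointwise_join_right _ _).join_of_left _).join_of_left _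
  simp only [not_exists]
  exact (h.forall_seq (P := fun b : ℕ → Fin 2 => oracleJoin (oracleJoin (oracleJoin p V) Z) b)).isOpen

/-- If no further column is common to all partners of the sequences that differ from `V`, then
there is a sequence that differs from `V` and a partner of it whose remaining columns are not
almost equal to those of countably many given sequences, and which avoids the cone above `C`. -/
theorem exists_offset_avoids (hR : IsEffClosed p R) {e : Fin m → Fin r} {L : List (Fin 3)}
    {V : ℕ → Fin 3} {Z : ℕ → Fin m → Fin 2} (hVZ : HasCommonColumns R e L V Z)
    (hmax : ∀ (L' : List (Fin 3)) (s : Fin r), s ∉ Set.range e →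
      ¬∃ Z', HasCommonColumns R (Fin.snoc e s : Fin (m + 1) → Fin r) L' V Z')
    {q : ℕ → ℕ} (hq : Avoids C q) (hqp : Pointwise (fun _ : Unit => q) fun _ => p)
    (hqV : Pointwise (fun _ : Unit => q) fun _ => V)
    (hqZ : Pointwise (fun _ : Unit => q) fun _ => Z)
    {𝒴 : Set (ℕ → Fin r → Fin 2)} (h𝒴 : 𝒴.Countable) :
    ∃ (b : ℕ → Fin 2) (Y : ℕ → Fin r → Fin 2), R (splice L (offset V b)) Y ∧
      (∀ n k, Y n (e k) = Z n k) ∧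
      (∀ Y' ∈ 𝒴, ∀ s ∉ Set.range e, ¬∃ n₀, ∀ n, n₀ ≤ n → Y n s = Y' n s) ∧
      Avoids C (oracleJoin (oracleJoin q b) Y) := by
  have : Countable 𝒴 := h𝒴.to_subtype
  let e' : Fin r → Fin (m + 1) → Fin r := fun s => Fin.snoc e s
  -- The candidate columns to be avoided: `Z` with one more column, a finite modification of a
  -- column of some `Y'`. There are countably many of them.
  let Z' : List (Fin 2) × 𝒴 × {s // s ∉ Set.range e} → ℕ → Fin (m + 1) → Fin 2 :=
    fun x n => Fin.snoc (Z n) (splice x.1 (fun n => x.2.1.1 n x.2.2.1) n)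
  let D : List (Fin 2) × 𝒴 × {s // s ∉ Set.range e} → Set (ℕ → Fin 2) := fun x =>
    {b | ¬∃ Y, R (splice L (offset V b)) Y ∧ ∀ n k, Y n (e' x.2.2.1 k) = Z' x n k}
  obtain ⟨b, hb, hqb⟩ := exists_generic_avoids hq (𝒰 := Set.range D) (Set.countable_range D)
    (by
      rintro _ ⟨x, rfl⟩
      exact hR.isOpen_not_exists_columns _ _ _ _)
    (by
      rintro _ ⟨x, rfl⟩
      refine dense_iff_splice.2 fun w => ?_
      by_contra hcon
      push Not at hcon
      let n := max L.length w.length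
      have hn : L.length ≤ n ∧ w.length ≤ n := ⟨le_max_left _ _, le_max_right _ _⟩
      -- Were the set not dense, all `b` extending some `w` would have a partner with the candidate
      -- columns. A string that covers both `L` and `w` then makes them common columns for `V`,
      -- against `hmax`.
      refine hmax (seqPrefix (splice L (offset V (splice w default))) n) x.2.2.1 x.2.2.2
        ⟨Z' x, fun b => ?_⟩
      have hb := not_not.1 (hcon b)
      suffices splice (seqPrefix (splice L (offset V (splice w default))) n) (offset V b) =
          splice L (offset V (splice w b)) by rw [this]; exact hb
      ext1 i
      rcases lt_or_ge i n with hi | hi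
      · rw [splice_seqPrefix_of_lt _ _ hi]
        rcases lt_or_ge i L.length with h | h
        · rw [splice_of_lt h, splice_of_lt h]
        · have h' : i < w.length := (lt_max_iff.1 hi).resolve_left h.not_gt
          rw [splice_of_le h, splice_of_le h, offset, offset, splice_of_lt h', splice_of_lt h']
      · rw [splice_seqPrefix_of_le _ _ hi, splice_of_le (hn.1.trans hi), offset, offset,
          splice_of_le (hn.2.trans hi)])
  obtain ⟨Y, ⟨hY, hYZ⟩, hqY⟩ := exists_mem_avoids hqb
    (S := fun Y => R (splice L (offset V b)) Y ∧ ∀ n k, Y n (e k) = Z n k)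
    (hR.relOpen_fiber e (X := fun _ => splice L (offset V b)) (Y := fun Y => Y)
      (Z := fun _ => Z)
      (((hqp.reindex fun _ => ()).join_of_left _).join_of_left _)
      ((((((hqV.reindex fun _ => ()).join_of_left _).offset
        (pointwise_join_right _ _)).splice L)).join_of_left _)
      (pointwise_join_right _ _)
      (((hqZ.reindex fun _ => ()).join_of_left _).join_of_left _))
    (hVZ b)
  refine ⟨b, Y, hY, hYZ, ?_, hqY⟩
  rintro Y' hY' s hs ⟨n₀, hn₀⟩
  -- If a column of `Y` were almost that of `Y'`, overwriting the latter by the first `n₀` values of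
  -- the former would give exactly a forbidden candidate.
  refine hb _ ⟨(seqPrefix (fun n => Y n s) n₀, ⟨Y', hY'⟩, ⟨s, hs⟩), rfl⟩ ⟨Y, hY, fun n k => ?_⟩
  refine Fin.lastCases ?_ (fun k => ?_) k
  · simp only [e', Z', Fin.snoc_last]
    rw [splice_seqPrefix_self (X := fun n => Y n s) (Y := fun n => Y' n s) hn₀]
  · simp only [e', Z', Fin.snoc_castSucc, hYZ]

end CrossConstraint

/-! ### The induction on the number of columns -/

section MainInduction

variable {r m : ℕ} {C : Set ℕ} {p : ℕ → ℕ}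
  {R : (ℕ → Fin 3) → (ℕ → Fin r → Fin 2) → Prop}

/-- Every sequence that extends `M` has a section with common columns beyond `L`. -/
def AllHaveCommonColumns (R : (ℕ → Fin 3) → (ℕ → Fin r → Fin 2) → Prop) (e : Fin m → Fin r)
    (L M : List (Fin 3)) : Prop :=
  ∀ V, ∃ Z, HasCommonColumns R e L (splice M V) Z

/-- With no columns selected the condition is just fullness of `R`, and injectivity bounds the
number of selected columns by `r`. -/
theorem exists_max_commonColumns (hfull : ∀ X, ∃ Y, R X Y) :
    ∃ m ≤ r, (∃ e : Fin m → Fin r, Function.Injective e ∧ ∃ L M, AllHaveCommonColumns R e L M) ∧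
      ∀ e : Fin (m + 1) → Fin r, Function.Injective e → ∀ L M, ¬AllHaveCommonColumns R e L M := by
  classical
  let P : ℕ → Prop := fun m =>
    ∃ e : Fin m → Fin r, Function.Injective e ∧ ∃ L M, AllHaveCommonColumns R e L M
  have h0 : P 0 := by
    refine ⟨Fin.elim0, fun i => i.elim0, [], [], fun V => ⟨fun _ => default, fun b => ?_⟩⟩
    obtain ⟨Y, hY⟩ := hfull (splice [] (offset (splice [] V) b))
    exact ⟨Y, hY, fun _ k => k.elim0⟩
  refine ⟨Nat.findGreatest P r, Nat.findGreatest_le r, Nat.findGreatest_spec (Nat.zero_le r) h0,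
    fun e he L M h => ?_⟩
  have hle : Nat.findGreatest P r + 1 ≤ r := by
    simpa using Fintype.card_le_of_injective e he
  exact Nat.findGreatest_is_greatest (Nat.lt_succ_self _) hle ⟨e, he, L, M, h⟩

/-- A pair of members of `R` that solves the cross-constraint problem, whose first sequence lies
in all the sets of the family `𝒰`, and that avoids the cone above `C` together with `p`. -/
def HasAvoidingSolution (C : Set ℕ) (p : ℕ → ℕ)
    (R : (ℕ → Fin 3) → (ℕ → Fin r → Fin 2) → Prop) (𝒰 : Set (Set (ℕ → Fin 3))) : Prop :=
  ∃ X₀ Y₀ X₁ Y₁, R X₀ Y₀ ∧ R X₁ Y₁ ∧ FinitelyCompatible X₀ X₁ ∧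
    (∀ s, InfinitelyCompatible (fun n => Y₀ n s) fun n => Y₁ n s) ∧ (∀ O ∈ 𝒰, X₀ ∈ O) ∧
    Avoids C (oracleJoin (oracleJoin (oracleJoin (oracleJoin p X₀) Y₀) X₁) Y₁)

/-- The family of the preimages under all `splice N` of the sets of a family. -/
def splicePreimages {σ : Type*} (𝒰 : Set (Set (ℕ → σ))) : Set (Set (ℕ → σ)) :=
  Set.range fun x : List σ × 𝒰 => splice x.1 ⁻¹' x.2.1

/-- Solutions will agree with a generic sequence only almost everywhere, so all finite modifications
of `G` have to be generic. -/
theorem exists_generic_splice_avoids (hp : Avoids C p) {𝒰 : Set (Set (ℕ → Fin 3))}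
    (hc : 𝒰.Countable) (ho : ∀ O ∈ 𝒰, IsOpen O) (hd : ∀ O ∈ 𝒰, Dense O) :
    ∃ G : ℕ → Fin 3, (∀ O ∈ 𝒰, ∀ N, splice N G ∈ O) ∧ Avoids C (oracleJoin p G) := by
  have : Countable 𝒰 := hc.to_subtype
  obtain ⟨G, hG, h⟩ := exists_generic_avoids hp (𝒰 := splicePreimages 𝒰) (Set.countable_range _)
    (by rintro _ ⟨x, rfl⟩; exact (ho _ x.2.2).preimage_splice _)
    (by rintro _ ⟨x, rfl⟩; exact (hd _ x.2.2).preimage_splice _)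
  exact ⟨G, fun O hO N => hG _ ⟨(N, ⟨O, hO⟩), rfl⟩, h⟩

/-- When every column is shared, partners with the shared columns coincide. Two sequences that
differ from each other and from `V` almost everywhere then have one partner `Y` in common, and `Y`
is infinitely compatible with itself. -/
theorem hasAvoidingSolution_of_surjective (hp : Avoids C p) (hR : IsEffClosed p R)
    {e : Fin m → Fin r} (he : Function.Surjective e) {L M : List (Fin 3)}
    (hLM : AllHaveCommonColumns R e L M) {𝒰 : Set (Set (ℕ → Fin 3))} (hc : 𝒰.Countable)
    (ho : ∀ O ∈ 𝒰, IsOpen O) (hd : ∀ O ∈ 𝒰, Dense O) : HasAvoidingSolution C p R 𝒰 := by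
  obtain ⟨G, hG, hpG⟩ := exists_generic_splice_avoids hp hc ho hd
  -- Modulo 3, `G + 2 + 1 + c = G + c`. Thus `X 0` is almost `G`, hence generic, and `X 1` is almost
  -- `G + 1`.
  let V : ℕ → Fin 3 := splice M fun n => G n + 2
  let X : Fin 2 → ℕ → Fin 3 := fun c => splice L (offset V fun _ => c)
  have hX : ∀ c n, max L.length M.length ≤ n → X c n = G n + c.castSucc := by
    intro c n hn
    simp only [X, V]
    rw [splice_of_le (le_of_max_le_left hn), offset, splice_of_le (le_of_max_le_right hn)]
    have : ∀ (g : Fin 3) (c : Fin 2), g + 2 + 1 + c.castSucc = g + c.castSucc := by decide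
    exact this _ _
  obtain ⟨Z, hZ⟩ := hLM fun n => G n + 2
  have hY : ∃ Y, R (X 0) Y ∧ R (X 1) Y := by
    obtain ⟨Y₀, h₀, h₀'⟩ := hZ fun _ => 0
    obtain ⟨Y₁, h₁, h₁'⟩ := hZ fun _ => 1
    have : Y₀ = Y₁ := by
      ext1 n
      ext1 s
      obtain ⟨k, rfl⟩ := he s
      rw [h₀', h₁']
    exact ⟨Y₀, h₀, this ▸ h₁⟩
  have pX : ∀ c, Pointwise (fun _ : Unit => oracleJoin p G) fun _ => X c := fun c =>
    ((((pointwise_join_right (fun _ : Unit => p) fun _ => G).map (f := fun _ g => g + 2)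
      ((Primrec.dom_finite _).comp₂ Primrec₂.right)).splice M).offset (pointwise_const c)).splice L
  obtain ⟨Y, ⟨h₀, h₁⟩, hav⟩ := exists_mem_avoids hpG (S := fun Y => R (X 0) Y ∧ R (X 1) Y)
    (by
      have hpw : ∀ c, RelOpen (fun Y : ℕ → Fin r → Fin 2 => oracleJoin (oracleJoin p G) Y)
          fun Y => ¬R (X c) Y := fun c =>
        hR.relOpen ((pointwise_join_left _ _).join_of_left _)
          (((pX c).reindex fun _ => ()).join_of_left _) (pointwise_join_right _ _)
      exact ((hpw 0).or (hpw 1)).of_eq fun Y => by tauto) hY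
  refine ⟨X 0, Y, X 1, Y, h₀, h₁, ?_, fun s => ?_, fun O hO => ?_, hav.mono ?_⟩
  · refine finitelyCompatible_iff.2 ⟨max L.length M.length, fun n hn => ?_⟩
    rw [hX _ n hn, hX _ n hn]
    have : ∀ g : Fin 3, g + (0 : Fin 2).castSucc ≠ g + (1 : Fin 2).castSucc := by decide
    exact this _
  · rw [InfinitelyCompatible, finitelyCompatible_iff]
    rintro ⟨n₀, h⟩
    exact h n₀ le_rfl rfl
  · have e : splice (seqPrefix (X 0) (max L.length M.length)) G = X 0 :=
      splice_seqPrefix_self fun n hn => by rw [hX _ n hn]; simp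
    exact e ▸ hG O hO _
  · exact ((((((pointwise_join_left _ _).join_of_left _).join ((pX 0).join_of_left _)).join
      (pointwise_join_right _ _)).join ((pX 1).join_of_left _)).join (pointwise_join_right _ _))

/-- Iterates `exists_offset_avoids`, the partners already found forming the family to be avoided.
The oracle `q'` collects all of them, so that any one may be chosen later. -/
theorem exists_list_offset_avoids (hR : IsEffClosed p R) {e : Fin m → Fin r} {L : List (Fin 3)}
    {V : ℕ → Fin 3} {Z : ℕ → Fin m → Fin 2} (hVZ : HasCommonColumns R e L V Z)
    (hmax : ∀ (L' : List (Fin 3)) (s : Fin r), s ∉ Set.range e →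
      ¬∃ Z', HasCommonColumns R (Fin.snoc e s : Fin (m + 1) → Fin r) L' V Z')
    {q : ℕ → ℕ} (hq : Avoids C q) (hqp : Pointwise (fun _ : Unit => q) fun _ => p)
    (hqV : Pointwise (fun _ : Unit => q) fun _ => V)
    (hqZ : Pointwise (fun _ : Unit => q) fun _ => Z) (k : ℕ) :
    ∃ (l : List ((ℕ → Fin 2) × (ℕ → Fin r → Fin 2))) (q' : ℕ → ℕ), l.length = k ∧ Avoids C q' ∧
      (Pointwise (fun _ : Unit => q') fun _ => q) ∧
      (∀ x ∈ l, (Pointwise (fun _ : Unit => q') fun _ => x.1) ∧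
        (Pointwise (fun _ : Unit => q') fun _ => x.2) ∧
        R (splice L (offset V x.1)) x.2 ∧ ∀ n k, x.2 n (e k) = Z n k) ∧
      l.Pairwise fun x y => ∀ s ∉ Set.range e, ¬∃ n₀, ∀ n, n₀ ≤ n → x.2 n s = y.2 n s := by
  induction k with
  | zero => exact ⟨[], q, rfl, hq, Pointwise.refl _, by simp, List.Pairwise.nil⟩
  | succ k ih =>
    obtain ⟨l, q', hlen, hq', hq'q, hl, hpair⟩ := ih
    obtain ⟨b, Y, hY, hYZ, hne, hav⟩ := exists_offset_avoids hR hVZ hmax hq' (hq'q.trans hqp)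
      (hq'q.trans hqV) (hq'q.trans hqZ) (𝒴 := {Y | ∃ x ∈ l, x.2 = Y})
      ((List.finite_toSet l).image Prod.snd).countable
    refine ⟨(b, Y) :: l, _, by simp [hlen], hav, (hq'q.join_of_left _).join_of_left _, ?_,
      List.pairwise_cons.2 ⟨fun x hx => hne _ ⟨x, hx, rfl⟩, hpair⟩⟩
    intro x hx
    rcases List.mem_cons.1 hx with rfl | hx
    · exact ⟨(pointwise_join_right _ _).join_of_left _, pointwise_join_right _ _, hY, hYZ⟩
    · obtain ⟨h1, h2, h3⟩ := hl x hx
      exact ⟨(h1.join_of_left _).join_of_left _, (h2.join_of_left _).join_of_left _, h3⟩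

/-- If every entry had a bad column in `S`, two entries would have the same one by pigeonhole. Both
columns would almost everywhere be the complement of that of `W`, hence almost equal. -/
theorem exists_infinitelyCompatible_of_pairwise {σ : Type*} {S : Set (Fin r)}
    {l : List (σ × (ℕ → Fin r → Fin 2))} (hlen : r < l.length)
    (hpair : l.Pairwise fun x y => ∀ s ∈ S, ¬∃ n₀, ∀ n, n₀ ≤ n → x.2 n s = y.2 n s)
    (W : ℕ → Fin r → Fin 2) :
    ∃ x ∈ l, ∀ s ∈ S, InfinitelyCompatible (fun n => W n s) fun n => x.2 n s := by
  by_contra hcon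
  push Not at hcon
  choose f hfS hf using hcon
  obtain ⟨i, j, hij, hfij⟩ := Fintype.exists_ne_map_eq_of_card_lt
    (fun i : Fin l.length => f (l.get i) (l.get_mem i))
    (show Fintype.card (Fin r) < Fintype.card (Fin l.length) by simpa using hlen)
  wlog h : i < j generalizing i j
  · exact this j i hij.symm hfij.symm (lt_of_le_of_ne (not_lt.1 h) hij.symm)
  have h1 := finitelyCompatible_iff.1 (not_not.1 (hf _ (l.get_mem i)))
  have h2 := finitelyCompatible_iff.1 (not_not.1 (hf _ (l.get_mem j)))
  obtain ⟨n₁, h1⟩ := h1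
  obtain ⟨n₂, h2⟩ := h2
  refine List.pairwise_iff_get.1 hpair i j h _ (hfS _ (l.get_mem i)) ⟨max n₁ n₂, fun n hn => ?_⟩
  have e1 := h1 n (le_of_max_le_left hn)
  have e2 := h2 n (le_of_max_le_right hn)
  rw [← hfij] at e2
  generalize W n _ = w at e1 e2
  generalize (l.get i).2 n _ = x at e1 ⊢
  generalize (l.get j).2 n _ = y at e2 ⊢
  revert w x y
  decide

/-- The family `𝒰` is part of the induction because the step needs the first sequence of the smaller
problem to be generic: maximality of the number of shared columns speaks of all `V` in a cylinder,
and genericity transfers it to the one `V₀` in use. -/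
theorem hasAvoidingSolution (r : ℕ) : ∀ {p : ℕ → ℕ}, Avoids C p →
    ∀ {R : (ℕ → Fin 3) → (ℕ → Fin r → Fin 2) → Prop}, IsEffClosed p R → (∀ X, ∃ Y, R X Y) →
    ∀ {𝒰 : Set (Set (ℕ → Fin 3))}, 𝒰.Countable → (∀ O ∈ 𝒰, IsOpen O) → (∀ O ∈ 𝒰, Dense O) →
      HasAvoidingSolution C p R 𝒰 := by
  induction r using Nat.strong_induction_on with
  | _ r ih =>
  intro p hp R hR hfull 𝒰 hc ho hd
  obtain ⟨m, hmr, ⟨e, he, L, M, hLM⟩, hmax⟩ := exists_max_commonColumns hfull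
  rcases hmr.eq_or_lt with rfl | hmr
  · exact hasAvoidingSolution_of_surjective hp hR (Finite.surjective_of_injective he) hLM hc ho hd
  let D : List (Fin 3) × {s // s ∉ Set.range e} → Set (ℕ → Fin 3) := fun x =>
    {V | ¬∃ Z, HasCommonColumns R (Fin.snoc e x.2.1 : Fin (m + 1) → Fin r) x.1 V Z}
  have hcD : (𝒰 ∪ Set.range D).Countable := hc.union (Set.countable_range D)
  have hoD : ∀ O ∈ 𝒰 ∪ Set.range D, IsOpen O := by
    rintro O (hO | ⟨x, rfl⟩)
    · exact ho O hO
    · exact hR.isOpen_not_exists_hasCommonColumns _ _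
  have hdD : ∀ O ∈ 𝒰 ∪ Set.range D, Dense O := by
    rintro O (hO | ⟨x, rfl⟩)
    · exact hd O hO
    · refine dense_iff_splice.2 fun M' => ?_
      by_contra hcon
      push Not at hcon
      -- If the set missed the cylinder of `M'`, every `V` extending `M'` would have an additional
      -- common column, contradicting maximality.
      refine hmax _ ?_ x.1 M' fun V => not_not.1 (hcon V)
      exact Fin.snoc_injective_iff.2 ⟨he, x.2.2⟩
  have : Countable ↑(𝒰 ∪ Set.range D) := hcD.to_subtype
  obtain ⟨V₀, Z₀, V₁, Z₁, h₀, h₁, hfin, hinf, hgen, hav⟩ := ih m hmr hp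
    (hR.hasCommonColumns e L M) hLM (𝒰 := splicePreimages (𝒰 ∪ Set.range D))
    (Set.countable_range _)
    (by rintro _ ⟨x, rfl⟩; exact (hoD _ x.2.2).preimage_splice _)
    (by rintro _ ⟨x, rfl⟩; exact (hdD _ x.2.2).preimage_splice _)
  have hgen' : ∀ O ∈ 𝒰 ∪ Set.range D, ∀ N, splice N V₀ ∈ O := fun O hO N =>
    hgen _ ⟨(N, ⟨O, hO⟩), rfl⟩
  obtain ⟨n₀, hn₀⟩ := finitelyCompatible_iff.1 hfin
  obtain ⟨l, q, hlen, hq, hq₀, hl, hpair⟩ := exists_list_offset_avoids hR h₀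
    (fun L' s hs => hgen' _ (Or.inr ⟨(L', ⟨s, hs⟩), rfl⟩) M) hav
    ((((pointwise_join_left _ _).join_of_left _).join_of_left _).join_of_left _)
    (((((pointwise_join_right _ _).join_of_left _).join_of_left _).join_of_left _).splice M)
    (((pointwise_join_right _ _).join_of_left _).join_of_left _) (r + 1)
  let n₁ := max n₀ M.length
  -- Beyond `n₁` the two sequences differ, and distinct elements of `Fin 3` differ by `1` or `2`; so
  -- `V₀` is there an offset of `V₁`. The value `0` below `n₁` is arbitrary.
  have hb : ∀ n, ∃ c : Fin 2, n₁ ≤ n →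
      splice M V₀ n = splice M V₁ n + 1 + c.castSucc := by
    intro n
    by_cases hn : n₁ ≤ n
    · have key : ∀ x y : Fin 3, x ≠ y → ∃ c : Fin 2, x = y + 1 + c.castSucc := by decide
      have hM : M.length ≤ n := le_of_max_le_right hn
      obtain ⟨c, hc⟩ := key _ _ (hn₀ n (le_of_max_le_left hn))
      exact ⟨c, fun _ => by rw [splice_of_le hM, splice_of_le hM, hc]⟩
    · exact ⟨0, fun h => absurd h hn⟩
  choose b hb using hb
  let W : ℕ → Fin 3 := splice L (offset (splice M V₁) b)
  have hW : ∀ n, max L.length n₁ ≤ n → W n = splice M V₀ n := fun n hn => by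
    rw [hb n (le_of_max_le_right hn)]
    exact splice_of_le (le_of_max_le_left hn) _
  -- As a finite modification of `V₀`, the sequence `W` inherits its genericity and is obtained from
  -- `q`.
  have hWV : splice (seqPrefix W (max L.length n₁)) V₀ = W :=
    splice_seqPrefix_self fun n hn => by
      rw [hW n hn, splice_of_le]
      exact (le_max_right n₀ _).trans (le_of_max_le_right hn)
  have pW : Pointwise (fun _ : Unit => q) fun _ => W :=
    hWV ▸ hq₀.trans (((((pointwise_join_right _ _).join_of_left _).join_of_left _).join_of_left
      _).splice _)
  have pp : Pointwise (fun _ : Unit => q) fun _ => p :=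
    hq₀.trans ((((pointwise_join_left _ _).join_of_left _).join_of_left _).join_of_left _)
  -- `W` is an offset of `V₁` beyond `L`, so it has partners with columns `Z₁`; the basis theorem
  -- selects one that preserves avoidance.
  obtain ⟨Y, ⟨hY, hYZ⟩, havY⟩ := exists_mem_avoids hq
    (S := fun Y => R W Y ∧ ∀ n k, Y n (e k) = Z₁ n k)
    (hR.relOpen_fiber e (X := fun _ => W) (Y := fun Y => Y) (Z := fun _ => Z₁)
      ((pp.reindex fun _ => ()).join_of_left _) ((pW.reindex fun _ => ()).join_of_left _)
      (pointwise_join_right _ _)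
      (((hq₀.trans (pointwise_join_right _ _)).reindex fun _ => ()).join_of_left _))
    (h₁ b)
  obtain ⟨x, hx, hxY⟩ := exists_infinitelyCompatible_of_pairwise (by omega) hpair Y
  obtain ⟨px₁, px₂, hxR, hxZ⟩ := hl x hx
  refine ⟨W, Y, splice L (offset (splice M V₀) x.1), x.2, hY, hxR, ?_, fun s => ?_,
    fun O hO => hWV ▸ hgen' O (Or.inl hO) _, havY.mono ?_⟩
  · refine finitelyCompatible_iff.2 ⟨max L.length n₁, fun n hn => ?_⟩
    rw [hW n hn, splice_of_le (le_of_max_le_left hn)]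
    exact (offset_ne _ _ _).symm
  · by_cases hs : s ∈ Set.range e
    · obtain ⟨k, rfl⟩ := hs
      simp only [hYZ, hxZ]
      exact (hinf k).symm
    · exact hxY s hs
  · have pV₀ : Pointwise (fun _ : Unit => q) fun _ => V₀ :=
      hq₀.trans (((pointwise_join_right _ _).join_of_left _).join_of_left _ |>.join_of_left _)
    exact ((((pp.join_of_left _).join (pW.join_of_left _)).join (pointwise_join_right _ _)).join
      ((((pV₀.splice M).offset px₁).splice L).join_of_left _)).join (px₂.join_of_left _)

end MainInduction

/-! ### Turing reducibility, joins and sets decided by an oracle -/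

section TuringReducibility

variable {A B G : Set ℕ}

theorem SetTuringLE.refl (A : Set ℕ) : SetTuringLE A A :=
  TuringReducible.refl _

theorem SetTuringLE.trans (h : SetTuringLE A B) (h' : SetTuringLE B G) : SetTuringLE A G :=
  TuringReducible.trans h h'

theorem mem_setJoin {n : ℕ} :
    n ∈ setJoin A B ↔ n % 2 = 0 ∧ n / 2 ∈ A ∨ n % 2 = 1 ∧ n / 2 ∈ B := by
  constructor
  · rintro (⟨k, hk, rfl⟩ | ⟨k, hk, rfl⟩)
    · left; simpa using hk
    · right
      have : (2 * k + 1) / 2 = k := by omega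
      simpa [this, Nat.add_mod] using hk
  · rintro (⟨h, hn⟩ | ⟨h, hn⟩)
    · exact Or.inl ⟨n / 2, hn, by dsimp only; omega⟩
    · exact Or.inr ⟨n / 2, hn, by dsimp only; omega⟩

theorem charFun_setJoin (n : ℕ) : charFun (setJoin A B) n =
    if n % 2 = 0 then charFun A (n / 2) else charFun B (n / 2) := by
  classical
  have h := Nat.mod_two_eq_zero_or_one n
  rcases h with h | h <;> simp [charFun, Set.indicator_apply, mem_setJoin, h]

theorem SetTuringLE.of_primrec {f : ℕ → ℕ} (hf : Primrec f)
    (h : ∀ n, charFun A n = charFun B (f n)) : SetTuringLE A B := by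
  refine RecursiveIn.iff_nat.2 ?_
  refine ((Nat.RecursiveIn.oracle (O := {fun n => Part.some (charFun B n)}) _ rfl).comp
    (Nat.Primrec.recursiveIn (Primrec.nat_iff.1 hf))).of_eq fun n => ?_
  simp [h]

theorem setTuringLE_setJoin_left (A B : Set ℕ) : SetTuringLE A (setJoin A B) :=
  SetTuringLE.of_primrec (Primrec.nat_mul.comp (Primrec.const 2) Primrec.id) fun n => by
    simp [charFun_setJoin]

theorem setTuringLE_setJoin_right (A B : Set ℕ) : SetTuringLE B (setJoin A B) :=
  SetTuringLE.of_primrec (f := fun n => 2 * n + 1)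
    (Primrec.succ.comp (Primrec.nat_mul.comp (Primrec.const 2) Primrec.id)) fun n => by
    have : (2 * n + 1) / 2 = n := by omega
    simp [charFun_setJoin, this, Nat.add_mod]

theorem SetTuringLE.setJoin (hA : SetTuringLE A G) (hB : SetTuringLE B G) :
    SetTuringLE (setJoin A B) G := by
  have hA := RecursiveIn.iff_nat.1 hA
  have hB := RecursiveIn.iff_nat.1 hB
  refine RecursiveIn.iff_nat.2 ?_
  have hdiv : Nat.RecursiveIn {fun n => Part.some (charFun G n)} fun n => ((n / 2 : ℕ) : Part ℕ) :=
    Nat.Primrec.recursiveIn (Primrec.nat_iff.1 (Primrec.nat_div.comp Primrec.id (Primrec.const 2)))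
  have hid : Nat.RecursiveIn {fun n => Part.some (charFun G n)} fun n => ((n : ℕ) : Part ℕ) :=
    Nat.Primrec.recursiveIn (Primrec.nat_iff.1 Primrec.id)
  have hsel : Nat.RecursiveIn {fun n => Part.some (charFun G n)} fun x =>
      ((if x.unpair.1 % 2 = 0 then x.unpair.2.unpair.1 else x.unpair.2.unpair.2 : ℕ) : Part ℕ) := by
    refine Nat.Primrec.recursiveIn (Primrec.nat_iff.1 ?_)
    have p1 := Primrec.fst.comp Primrec.unpair
    have p2 := Primrec.snd.comp Primrec.unpair
    exact Primrec.ite (Primrec.eq.comp (Primrec.nat_mod.comp p1 (Primrec.const 2))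
      (Primrec.const 0)) (p1.comp p2) (p2.comp p2)
  refine (hsel.comp (hid.pair ((hA.comp hdiv).pair (hB.comp hdiv)))).of_eq fun n => ?_
  simp [charFun_setJoin, Seq.seq]

variable {q : ℕ → ℕ}

theorem DecidedBy.setJoin (hA : DecidedBy q A) (hB : DecidedBy q B) :
    DecidedBy q (setJoin A B) := by
  have hdiv : Primrec fun n : ℕ => n / 2 := Primrec.nat_div.comp Primrec.id (Primrec.const 2)
  have hmod (k : ℕ) : EnumIn q fun n : ℕ => n % 2 = k := EnumIn.of_primrecPred
    (Primrec.eq.comp (Primrec.nat_mod.comp Primrec.id (Primrec.const 2)) (Primrec.const k))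
  refine ⟨(((hmod 0).and (hA.1.comp hdiv)).or ((hmod 1).and (hB.1.comp hdiv))).of_eq
    fun n => mem_setJoin.symm,
    (((hmod 0).and (hA.2.comp hdiv)).or ((hmod 1).and (hB.2.comp hdiv))).of_eq fun n => ?_⟩
  rcases Nat.mod_two_eq_zero_or_one n with h | h <;> simp [mem_setJoin, h]

theorem Pointwise.decidedBy {σ : Type*} [Primcodable σ] {X : ℕ → σ}
    (hX : Pointwise (fun _ : Unit => q) fun _ => X) {f : ℕ → ℕ} (hf : Primrec f)
    {S : ℕ → σ → Prop} (hS : PrimrecRel S) (hA : ∀ m, m ∈ A ↔ S m (X (f m))) : DecidedBy q A := by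
  have key : ∀ {S : ℕ → σ → Prop}, PrimrecRel S → EnumIn q fun m => S m (X (f m)) := by
    intro S hS
    have h1 : EnumIn q fun x : ℕ × σ => X (f x.1) = x.2 :=
      hX.enumIn_graph.comp (f := fun x : ℕ × σ => (f x.1, x.2))
        ((hf.comp Primrec.fst).pair Primrec.snd)
    exact (h1.and (EnumIn.of_primrecPred hS)).exists.of_eq fun m => by simp
  exact ⟨(key hS).of_eq fun m => (hA m).symm,
    (key (S := fun m x => ¬S m x) (PrimrecPred.not hS)).of_eq fun m => not_congr (hA m).symm⟩

theorem Pointwise.decidedBy_of_charFun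
    (h : Pointwise (fun _ : Unit => q) fun _ => charFun A) : DecidedBy q A :=
  h.decidedBy Primrec.id (S := fun _ y => y = 1) (Primrec.eq.comp Primrec.snd (Primrec.const 1))
    fun m => by by_cases hm : m ∈ A <;> simp [charFun, hm]

end TuringReducibility

/-! ### From cross-trees to closed relations, and the sequence behind the ideal -/

section Instances

variable {r : ℕ}

theorem Pointwise.decidedBy_toSet {q : ℕ → ℕ} {P : CrossPoint r}
    (hX : Pointwise (fun _ : Unit => q) fun _ => P.1)
    (hY : Pointwise (fun _ : Unit => q) fun _ n s => P.2 s n) : DecidedBy q P.toSet := by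
  have hZ := hX.map₂ hY (f := Prod.mk) Primrec₂.pair
  have p1 := Primrec.fst.comp Primrec.unpair
  have p2 := Primrec.snd.comp Primrec.unpair
  refine hZ.decidedBy (f := fun m => m.unpair.2.unpair.1) (p1.comp p2)
    (S := fun m z => m.unpair.1 = 0 ∧ m.unpair.2.unpair.2 = (z.1 : ℕ) ∨
      ∃ s ∈ List.finRange r, m.unpair.1 = (s : ℕ) + 1 ∧ m.unpair.2.unpair.2 = (z.2 s : ℕ))
    (PrimrecPred.or (PrimrecPred.and ?_ ?_) ?_) fun m => ?_
  · exact Primrec.eq.comp (p1.comp Primrec.fst) (Primrec.const 0)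
  · exact Primrec.eq.comp ((p2.comp p2).comp Primrec.fst)
      (Primrec.fin_val.comp (Primrec.fst.comp Primrec.snd))
  · refine (PrimrecRel.exists_mem_list (R := fun (s : Fin r)
      (x : ℕ × (Fin 3 × (Fin r → Fin 2))) => x.1.unpair.1 = (s : ℕ) + 1 ∧
        x.1.unpair.2.unpair.2 = (x.2.2 s : ℕ)) (PrimrecPred.and ?_ ?_)).comp
      (Primrec.const (List.finRange r)) Primrec.id
    · exact Primrec.eq.comp (p1.comp (Primrec.fst.comp Primrec.snd))
        (Primrec.succ.comp (Primrec.fin_val.comp Primrec.fst))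
    · exact Primrec.eq.comp ((p2.comp p2).comp (Primrec.fst.comp Primrec.snd))
        (Primrec.fin_val.comp (Primrec.fin_app.comp
          (Primrec.snd.comp (Primrec.snd.comp Primrec.snd)) Primrec.fst))
  · obtain ⟨⟨a, n, v⟩, rfl⟩ : ∃ x : ℕ × ℕ × ℕ, m = Nat.pair x.1 (Nat.pair x.2.1 x.2.2) :=
      ⟨(m.unpair.1, m.unpair.2.unpair.1, m.unpair.2.unpair.2), by simp⟩
    simp only [CrossPoint.toSet, Set.mem_union, Set.mem_ofPred_eq, Nat.pair_eq_pair,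
      Nat.unpair_pair, List.mem_finRange, true_and]
    refine or_congr ?_ (exists_congr fun s => ?_)
    · exact ⟨fun ⟨_, h, rfl, h'⟩ => ⟨h, h'⟩, fun ⟨h, h'⟩ => ⟨_, h, rfl, h'⟩⟩
    · exact ⟨fun ⟨_, h, rfl, h'⟩ => ⟨h, h'⟩, fun ⟨h, h'⟩ => ⟨_, h, rfl, h'⟩⟩

theorem mem_crossCode {T : Set (CrossString r)} {χ : CrossString r} :
    (Primcodable.toEncodable : Encodable (CrossString r)).encode χ ∈ crossCode T ↔ χ ∈ T :=
  (@Encodable.encode_injective _ (Primcodable.toEncodable : Encodable (CrossString r))).mem_set_image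

/-- The pair of strings recorded by a prefix of a twofold join of oracles. -/
def crossNode (r : ℕ) (l : List ℕ) : CrossString r :=
  (l.map fun y => (decode y.unpair.1.unpair.2).getD default,
    fun s => l.map fun y => 
    (((Primcodable.toEncodable : Encodable (Fin r → Fin 2)).decode y.unpair.2).getD default) s)

theorem primrec_crossNode (r : ℕ) : Primrec (crossNode r) := by
  have p1 := Primrec.fst.comp Primrec.unpair
  have p2 := Primrec.snd.comp Primrec.unpair
  refine Primrec.pair ?_ (Primrec.fin_curry.2 ?_)
  · exact Primrec.list_map Primrec.id
      ((Primrec.option_getD_default.comp (Primrec.decode.comp (p2.comp p1))).comp₂ Primrec₂.right)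
  · refine Primrec.list_map (f := fun x : List ℕ × Fin r => x.1) Primrec.fst ?_
    exact Primrec.fin_app.comp (Primrec.option_getD_default.comp
      (Primrec.decode.comp (p2.comp Primrec.snd))) (Primrec.snd.comp Primrec.fst)

theorem crossNode_oracleJoin (p : ℕ → ℕ) (X : ℕ → Fin 3) (Y : ℕ → Fin r → Fin 2) (n : ℕ) :
    crossNode r (oraclePrefix (oracleJoin (oracleJoin p X) Y) n) =
      (restrict X n, fun s => restrict (fun k => Y k s) n) := by
  have e : ∀ y : Fin r → Fin 2, (Primcodable.toEncodable : Encodable (Fin r → Fin 2)).decode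
      ((Primcodable.toEncodable : Encodable (Fin r → Fin 2)).encode y) = some y := fun y =>
    @Encodable.encodek _ (Primcodable.toEncodable : Encodable (Fin r → Fin 2)) y
  simp [crossNode, oraclePrefix, oracleJoin, restrict, e, Function.comp_def]

/-- A pair fails to be a path when some finite prefix of it is outside `T`, and the complement of
`T` is enumerable from `G`. -/
theorem isEffClosed_crossPaths {T : Set (CrossString r)} {G : Set ℕ}
    (h : SetTuringLE (crossCode T) G) :
    IsEffClosed (charFun G) fun X Y => (X, fun s k => Y k s) ∈ crossPaths T := by
  obtain ⟨U, hU, hUT⟩ := h.decidedBy.2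
  have hc : Primrec₂ fun (_ y : ℕ) => y.unpair.1.unpair.1 :=
    have p1 := Primrec.fst.comp Primrec.unpair
    (p1.comp p1).comp₂ Primrec₂.right
  have hV : EffOpen fun (x : Unit × List ℕ) p =>
      U ((Primcodable.toEncodable : Encodable (CrossString r)).encode (crossNode r x.2))
        fun m => (p m).unpair.1.unpair.1 :=
    (hU.subst_pointwise hc).comp (Primrec.encode.comp ((primrec_crossNode r).comp Primrec.snd))
  refine ⟨_, hV.exists_prefix, fun ⟨X, Y⟩ => ?_⟩
  have e : (fun m => (oracleJoin (oracleJoin (charFun G) X) Y m).unpair.1.unpair.1) = charFun G := by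
    ext m; simp [oracleJoin]
  simp only [e, ← hUT, mem_crossCode, crossNode_oracleJoin]
  simp [crossPaths]

/-- Every instance of the cross-constraint problem that is computable in `G` has a solution whose
join with `G` does not compute `C`. -/
theorem IsCCInstance.exists_solution_avoids {C G : Set ℕ} (hG : Avoids C (charFun G))
    {T : Set (CrossString r)} (hT : IsCCInstance T) (hTG : SetTuringLE (crossCode T) G) :
    ∃ P₀ P₁ : CrossPoint r, IsCCSolution T P₀ P₁ ∧
      Avoids C (charFun (setJoin G (setJoin P₀.toSet P₁.toSet))) := by
  have hfull : ∀ X : ℕ → Fin 3, ∃ Y : ℕ → Fin r → Fin 2,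
      (X, fun s k => Y k s) ∈ crossPaths T := fun X => by
    obtain ⟨Y, -, hY⟩ := hT.leftFull X rfl
    exact ⟨fun k s => Y s k, hY⟩
  obtain ⟨X₀, Y₀, X₁, Y₁, h₀, h₁, hX, hY, -, hC⟩ := hasAvoidingSolution r hG
    (isEffClosed_crossPaths hTG) hfull Set.countable_empty (by simp) (by simp)
  refine ⟨_, _, ⟨h₀, h₁, hX, hY⟩, hC.of_enumIn_graph (DecidedBy.enumIn_graph ?_)⟩
  have pG := (((Pointwise.refl fun _ : Unit => charFun G).join_of_left fun _ => X₀).join_of_left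
    fun _ => Y₀).join_of_left (fun _ => X₁) |>.join_of_left fun _ => Y₁
  have pX₀ := (((pointwise_join_right (fun _ : Unit => charFun G) fun _ => X₀).join_of_left
    fun _ => Y₀).join_of_left fun _ => X₁).join_of_left fun _ => Y₁
  have pY₀ := ((pointwise_join_right (fun _ : Unit => oracleJoin (charFun G) X₀)
    fun _ => Y₀).join_of_left fun _ => X₁).join_of_left fun _ => Y₁
  have pX₁ := (pointwise_join_right (fun _ : Unit => oracleJoin (oracleJoin (charFun G) X₀) Y₀)
    fun _ => X₁).join_of_left fun _ => Y₁
  have pY₁ := pointwise_join_right (fun _ : Unit =>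
    oracleJoin (oracleJoin (oracleJoin (charFun G) X₀) Y₀) X₁) fun _ => Y₁
  exact pG.decidedBy_of_charFun.setJoin
    ((Pointwise.decidedBy_toSet pX₀ pY₀).setJoin (Pointwise.decidedBy_toSet pX₁ pY₁))

theorem ComputablePred.crossCode_setTuringLE {T : Set (CrossString r)}
    (hT : ComputablePred fun χ => χ ∈ T) (G : Set ℕ) : SetTuringLE (crossCode T) G := by
  classical
  obtain ⟨hd, hT⟩ := hT
  -- `decode₂` rejects any number that is not the code of what it decodes to, so this function
  -- vanishes off the codes.
  have h : Computable fun n : ℕ => (((@decode₂ _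
      (Primcodable.toEncodable : Encodable (CrossString r)) n).map fun χ =>
        decide (χ ∈ T)).getD false).toNat := by
    refine (Primrec.dom_finite Bool.toNat).to_comp.comp ?_
    refine Computable.option_getD (Computable.option_map Primrec.decode₂.to_comp
      (hT.comp Computable.snd).to₂) (Computable.const false)
  have e : charFun (crossCode T) = fun n : ℕ => (((@decode₂ _
      (Primcodable.toEncodable : Encodable (CrossString r)) n).map fun χ =>
        decide (χ ∈ T)).getD false).toNat := by
    ext n
    by_cases hn : n ∈ crossCode T
    · obtain ⟨χ, hχ, rfl⟩ := id hn
      simp only [charFun, Set.indicator_of_mem hn, encodek₂]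
      simp [hχ]
    · rw [charFun, Set.indicator_of_notMem hn]
      cases hd : @decode₂ _ (Primcodable.toEncodable : Encodable (CrossString r)) n with
      | none => rfl
      | some χ =>
        have : χ ∉ T := fun hχ => hn ⟨χ, hχ, (@mem_decode₂ _ Primcodable.toEncodable n χ).1 hd⟩
        simp [this]
  rw [SetTuringLE, e]
  exact h.partrec.turingReducible

/-- The left component of a join. -/
def evens (A : Set ℕ) : Set ℕ :=
  {n | 2 * n ∈ A}

theorem evens_setJoin (A B : Set ℕ) : evens (setJoin A B) = A := by
  ext n; simp [evens, mem_setJoin]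

/-- The set of pairs of strings that `U` enumerates relative to `G`. -/
def enumTree (r : ℕ) (U : ℕ → (ℕ → ℕ) → Prop) (G : Set ℕ) : Set (CrossString r) :=
  {χ | U ((Primcodable.toEncodable : Encodable (CrossString r)).encode χ) (charFun G)}

/-- Names the instances computable in `G` by the countably many effectively open relations. -/
theorem SetTuringLE.exists_enumTree_eq {T : Set (CrossString r)} {G : Set ℕ}
    (h : SetTuringLE (crossCode T) G) : ∃ U, EffOpen U ∧ T = enumTree r U G := by
  obtain ⟨U, hU, hUT⟩ := h.decidedBy.1
  refine ⟨U, hU, ?_⟩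
  ext χ
  exact mem_crossCode.symm.trans (hUT _)

/-- There is an increasing sequence of sets that do not compute `C` along which every instance of
the cross-constraint problem is eventually solved. -/
theorem exists_sequence_avoids (r : ℕ) {C : Set ℕ} (hC : Avoids C (charFun ∅)) :
    ∃ G : ℕ → Set ℕ, (∀ n, Avoids C (charFun (G n))) ∧
      (∀ m n, m ≤ n → SetTuringLE (G m) (G n)) ∧
      ∀ m, ∀ T : Set (CrossString r), IsCCInstance T → SetTuringLE (crossCode T) (G m) →
        ∃ n P₀ P₁, IsCCSolution T P₀ P₁ ∧ SetTuringLE (setJoin P₀.toSet P₁.toSet) (G n) := by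
  have : Nonempty {U : ℕ → (ℕ → ℕ) → Prop // EffOpen U} :=
    ⟨_, effOpen_apply.comp (Primrec.id.pair Primrec.id)⟩
  obtain ⟨U, hU⟩ := exists_surjective_nat {U : ℕ → (ℕ → ℕ) → Prop // EffOpen U}
  -- Stage `k = Nat.pair i m` treats the tree that the `i`-th relation enumerates from `G m`, which
  -- is recovered from the current set by taking left components `k - m` times.
  let T (k : ℕ) (G : Set ℕ) : Set (CrossString r) :=
    enumTree r (U k.unpair.1).1 (evens^[k - k.unpair.2] G)
  have step (k : ℕ) (G : {G // Avoids C (charFun G)}) : ∃ H, Avoids C (charFun (setJoin G.1 H)) ∧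
      (IsCCInstance (T k G) → SetTuringLE (crossCode (T k G)) G →
        ∃ P₀ P₁, IsCCSolution (T k G) P₀ P₁ ∧ setJoin P₀.toSet P₁.toSet = H) := by
    by_cases h : IsCCInstance (T k G) ∧ SetTuringLE (crossCode (T k G)) G
    · obtain ⟨P₀, P₁, hP, hA⟩ := h.1.exists_solution_avoids G.2 h.2
      exact ⟨_, hA, fun _ _ => ⟨P₀, P₁, hP, rfl⟩⟩
    · refine ⟨G, G.2.of_enumIn_graph (DecidedBy.enumIn_graph ?_), fun h₁ h₂ => absurd ⟨h₁, h₂⟩ h⟩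
      exact (SetTuringLE.refl _).decidedBy.setJoin (SetTuringLE.refl _).decidedBy
  choose H hH hsol using step
  let G : ℕ → {G // Avoids C (charFun G)} := fun n =>
    Nat.rec ⟨∅, hC⟩ (fun k G => ⟨setJoin G.1 (H k G), hH k G⟩) n
  have hG : ∀ n, (G (n + 1)).1 = setJoin (G n).1 (H n (G n)) := fun n => rfl
  have hevens : ∀ d m, evens^[d] (G (m + d)).1 = (G m).1 := by
    intro d m
    induction d with
    | zero => rfl
    | succ d ih => rw [Function.iterate_succ_apply, ← add_assoc, hG, evens_setJoin, ih]
  have hmono : ∀ m n, m ≤ n → SetTuringLE (G m).1 (G n).1 := by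
    intro m n hmn
    induction hmn with
    | refl => exact SetTuringLE.refl _
    | @step n _ ih => exact ih.trans (hG n ▸ setTuringLE_setJoin_left _ _)
  refine ⟨fun n => (G n).1, fun n => (G n).2, hmono, fun m S hS hSm => ?_⟩
  obtain ⟨V, hV, hSV⟩ := hSm.exists_enumTree_eq
  obtain ⟨i, hi⟩ := hU ⟨V, hV⟩
  -- A pair is at least its second component, so `G m` is already available at the stage that treats
  -- it.
  have hmk : m ≤ Nat.pair i m := Nat.right_le_pair i m
  have hT : T (Nat.pair i m) (G (Nat.pair i m)).1 = S := by
    have := hevens (Nat.pair i m - m) m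
    rw [Nat.add_sub_cancel' hmk] at this
    simp only [T, Nat.unpair_pair, this, hi, hSV]
  obtain ⟨P₀, P₁, hP, h⟩ := hsol (Nat.pair i m) (G (Nat.pair i m)) (hT.symm ▸ hS)
    (hT.symm ▸ hSm.trans (hmono _ _ hmk))
  refine ⟨Nat.pair i m + 1, P₀, P₁, hT ▸ hP, ?_⟩
  rw [h]
  exact setTuringLE_setJoin_right _ _

end Instances

theorem mainTheorem8 (r : ℕ) (C : Set ℕ) (hC : ¬ ComputablePred (fun n : ℕ => n ∈ C)) :
    (∀ T : Set (CrossString r), IsCCInstance T →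
      ComputablePred (fun χ : CrossString r => χ ∈ T) →
      ∃ P₀ P₁ : CrossPoint r, IsCCSolution T P₀ P₁ ∧
        ¬ SetTuringLE C (setJoin P₀.toSet P₁.toSet)) ∧
    ∃ M : Set (Set ℕ), IsCrossConstraintIdeal r M ∧ C ∉ M := by
  have hC' := avoids_charFun_empty hC
  refine ⟨fun T hT hTc => ?_, ?_⟩
  · obtain ⟨P₀, P₁, hP, h⟩ := hT.exists_solution_avoids hC' (hTc.crossCode_setTuringLE ∅)
    exact ⟨P₀, P₁, hP, fun hCP => h.not_setTuringLE (hCP.trans (setTuringLE_setJoin_right _ _))⟩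
  · obtain ⟨G, hG, hmono, hsol⟩ := exists_sequence_avoids r hC'
    -- The ideal is the union of the lower cones of the increasing sequence `G n`.
    refine ⟨{A | ∃ n, SetTuringLE A (G n)}, ⟨⟨⟨_, 0, SetTuringLE.refl _⟩, ?_, ?_⟩, ?_⟩, ?_⟩
    · rintro A B hAB ⟨n, hB⟩
      exact ⟨n, hAB.trans hB⟩
    · rintro A ⟨m, hA⟩ B ⟨n, hB⟩
      exact ⟨max m n, (hA.trans (hmono _ _ (le_max_left m n))).setJoin
        (hB.trans (hmono _ _ (le_max_right m n)))⟩
    · rintro T hT ⟨m, hTm⟩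
      obtain ⟨n, P₀, P₁, hP, h⟩ := hsol m T hT hTm
      exact ⟨P₀, P₁, hP, n, h⟩
    · rintro ⟨n, hn⟩
      exact (hG n).not_setTuringLE hn
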